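/- Let $Y_1,Y_0$ be real random variables (potential outcomes), $X\in\{0,1\}$ a binary treatment, $W$ a random vector in $\mathbb{R}^{d}$, and $Y=XY_1+(1-X)Y_0$. Write $F_{Y,X,W}$ for the joint distribution of $(Y,X,W)$, $p_{x|w}=\mathbb{P}(X=x\mid W=w)$ and $F_{Y\mid X,W}(y\mid x,w)=\mathbb{P}(Y\le y\mid X=x,W=w)$. Statements "for all $w$" about conditional distributions given $W=w$ are understood for almost every $w$ with respect to the law of $W$. Assume (overlap) there is $\epsilon>0$ with $p_{1|w}\in[\epsilon,1-\epsilon]$ for all $w$; (marginal $c$-dependence) $\underline c,\overline c$ are measurable functions of $w$ with $0<\underline c(w)\le p_{1|w}\le\overline c(w)<1$ for all $w$, and, for $x\in\{0,1\}$, $\mathbb{P}(X=1\mid Y_x,W)\in[\underline c(W),\overline c(W)]$ almost surely. Let $\mathcal{I}^{\mathrm{marg}}(F_{Y,X,W};c)$ be the set of all triples $(F_1,F_0,C)$, where $F_1(\cdot\mid x,w)$ and $F_0(\cdot\mid x,w)$ are cdfs and $C(\cdot,\cdot\mid x,w)$ is a bivariate copula for each $(x,w)$, for which there is a joint distribution $\widetilde{\mathbb{P}}$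 of $(Y_1,Y_0,X,W)$ such that 1. the law of $(X,W)$ under $\widetilde{\mathbb{P}}$ is the observed one; 2. under $\widetilde{\mathbb{P}}$, $F_1(\cdot\mid x,w)$ and $F_0(\cdot\mid x,w)$ are the conditional cdfs of $Y_1$ and of $Y_0$ given $(X,W)=(x,w)$, and $\widetilde{\mathbb{P}}(Y_1\le y_1,Y_0\le y_0\mid X=x,W=w)=C\big(F_1(y_1\mid x,w),F_0(y_0\mid x,w)\mid x,w\big)$ for all $y_1,y_0$; 3. $F_1(\cdot\mid 1,w)=F_{Y\mid X,W}(\cdot\mid 1,w)$ and $F_0(\cdot\mid 0,w)=F_{Y\mid X,W}(\cdot\mid 0,w)$ for all $w$; 4. marginal $c$-dependence holds under $\widetilde{\mathbb{P}}$ with the same $\underline c,\overline c$. For $(y_1,y_0)\in\mathbb{R}^2$ let $$\theta_{\mathrm{CDF}}(F_1,F_0,C)=\sum_{x\in\{0,1\}}\int C\big(F_1(y_1\mid x,w),F_0(y_0\mid x,w)\mid x,w\big)\,p_{x|w}\,dF_W(w),$$ and define the identified set for $F_{Y_1,Y_0}(y_1,y_0)$ as $\{\theta_{\mathrm{CDF}}(F_1,F_0,C):(F_1,F_0,C)\in\mathcal{I}^{\mathrm{marg}}(F_{Y,X,W};c)\}$.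 Define $\underline F_{Y_x\mid X,W}(y\mid x,w)=\overline F_{Y_x\mid X,W}(y\mid x,w)=F_{Y\mid X,W}(y\mid x,w)$ for $x\in\{0,1\}$ and, with $\underline c=\underline c(w)$, $\overline c=\overline c(w)$, $G_x=F_{Y\mid X,W}(y\mid x,w)$, $$\underline F_{Y_1\mid X,W}(y\mid 0,w)=\max\Big\{G_1\tfrac{p_{1|w}(1-\overline c)}{p_{0|w}\overline c},\ \tfrac{\underline c-p_{1|w}}{\underline c\,p_{0|w}}+G_1\tfrac{p_{1|w}(1-\underline c)}{p_{0|w}\underline c}\Big\},$$ $$\overline F_{Y_1\mid X,W}(y\mid 0,w)=\min\Big\{G_1\tfrac{p_{1|w}(1-\underline c)}{p_{0|w}\underline c},\ \tfrac{\overline c-p_{1|w}}{\overline c\,p_{0|w}}+G_1\tfrac{p_{1|w}(1-\overline c)}{p_{0|w}\overline c}\Big\},$$ $$\underline F_{Y_0\mid X,W}(y\mid 1,w)=\max\Big\{G_0\tfrac{p_{0|w}\underline c}{p_{1|w}(1-\underline c)},\ \tfrac{p_{1|w}-\overline c}{(1-\overline c)p_{1|w}}+G_0\tfrac{p_{0|w}\overline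 c}{p_{1|w}(1-\overline c)}\Big\},$$ $$\overline F_{Y_0\mid X,W}(y\mid 1,w)=\min\Big\{G_0\tfrac{p_{0|w}\overline c}{p_{1|w}(1-\overline c)},\ \tfrac{p_{1|w}-\underline c}{(1-\underline c)p_{1|w}}+G_0\tfrac{p_{0|w}\underline c}{p_{1|w}(1-\underline c)}\Big\}.$$ Then, for every $(y_1,y_0)\in\mathbb{R}^2$, the identified set for $F_{Y_1,Y_0}(y_1,y_0)$ equals the closed interval $$\Big[\mathbb{E}\max\{\underline F_{Y_1\mid X,W}(y_1\mid X,W)+\underline F_{Y_0\mid X,W}(y_0\mid X,W)-1,\,0\},\ \ \mathbb{E}\min\{\overline F_{Y_1\mid X,W}(y_1\mid X,W),\,\overline F_{Y_0\mid X,W}(y_0\mid X,W)\}\Big].$$ -/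

import Mathlib

open MeasureTheory ProbabilityTheory Set Filter Topology

/-- The space of covariate values `w`. -/
abbrev Cov (d : ℕ) : Type := EuclideanSpace ℝ (Fin d)

/-- Values `(y₁, y₀, x, w)` of potential outcomes, binary treatment and covariates. -/
abbrev Latent (d : ℕ) : Type := ℝ × ℝ × Fin 2 × Cov d

/-- Values `(y, x, w)` of the observables: realized outcome, binary treatment and covariates. -/
abbrev Observed (d : ℕ) : Type := ℝ × Fin 2 × Cov d

/-- The potential outcome `Y_x`, as a coordinate of the latent space. -/
def outcome {d : ℕ} (x : Fin 2) (z : Latent d) : ℝ := if x = 1 then z.1 else z.2.1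

/-- The observables `(Y, X, W)`, with `Y = Y₁` if `X = 1` and `Y = Y₀` if `X = 0`. -/
def observe {d : ℕ} (z : Latent d) : Observed d := (outcome z.2.2.1 z, z.2.2)

theorem measurable_observe {d : ℕ} : Measurable (observe (d := d)) := by
  refine Measurable.prodMk ?_ (by fun_prop)
  refine Measurable.ite ?_ (by fun_prop) (by fun_prop)
  exact (measurableSet_singleton (1 : Fin 2)).preimage
    (f := fun z : Latent d => z.2.2.1) (by fun_prop)

/-- The law `F_{Y,X,W}` of the observables when `(Y₁, Y₀, X, W)` has law `P`. -/
noncomputable def observedLaw {d : ℕ} (P : Measure (Latent d)) : Measure (Observed d) :=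
  P.map observe

instance {d : ℕ} (P : Measure (Latent d)) [IsProbabilityMeasure P] :
    IsProbabilityMeasure (observedLaw P) :=
  Measure.isProbabilityMeasure_map measurable_observe.aemeasurable

/-- `p_{x|w} = P(X = x | W = w)`, where `ρ` is the law of `(X, W)`. -/
noncomputable def propensity {d : ℕ} (ρ : Measure (Fin 2 × Cov d)) [IsProbabilityMeasure ρ]
    (x : Fin 2) (w : Cov d) : ℝ :=
  (condDistrib Prod.fst Prod.snd ρ w).real {x}

/-- `F_{Y|X,W}(y | x, w)`, where `Q` is the law of `(Y, X, W)`. -/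
noncomputable def observedCDF {d : ℕ} (Q : Measure (Observed d)) [IsProbabilityMeasure Q]
    (x : Fin 2) (w : Cov d) (y : ℝ) : ℝ :=
  (condDistrib Prod.fst Prod.snd Q (x, w)).real (Iic y)

/-- `F_{Y_a|X,W}(y | x, w)`, where `P` is the law of `(Y₁, Y₀, X, W)`. -/
noncomputable def outcomeCDF {d : ℕ} (P : Measure (Latent d)) [IsProbabilityMeasure P]
    (a : Fin 2) (x : Fin 2) (w : Cov d) (y : ℝ) : ℝ :=
  (condDistrib (outcome a) (fun z : Latent d => z.2.2) P (x, w)).real (Iic y)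

/-- `F_{Y₁,Y₀|X,W}(y₁, y₀ | x, w)`, where `P` is the law of `(Y₁, Y₀, X, W)`. -/
noncomputable def jointOutcomeCDF {d : ℕ} (P : Measure (Latent d)) [IsProbabilityMeasure P]
    (x : Fin 2) (w : Cov d) (y₁ y₀ : ℝ) : ℝ :=
  (condDistrib (fun z : Latent d => (z.1, z.2.1)) (fun z : Latent d => z.2.2) P (x, w)).real
    (Iic y₁ ×ˢ Iic y₀)

/-- The latent propensity score `p_a(y, w) = P(X = 1 | Y_a = y, W = w)`, where `P` is the law of
`(Y₁, Y₀, X, W)`. -/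
noncomputable def latentPropensity {d : ℕ} (P : Measure (Latent d)) [IsProbabilityMeasure P]
    (a : Fin 2) (y : ℝ) (w : Cov d) : ℝ :=
  (condDistrib (fun z : Latent d => z.2.2.1) (fun z : Latent d => (outcome a z, z.2.2.2)) P
    (y, w)).real {1}

/-- Strict overlap; `ρ` is the law of `(X, W)`, so `ρ.snd` is the law of `W`. -/
def Overlap {d : ℕ} (ρ : Measure (Fin 2 × Cov d)) [IsProbabilityMeasure ρ] : Prop :=
  ∃ ε : ℝ, 0 < ε ∧ ∀ᵐ w ∂ρ.snd, propensity ρ 1 w ∈ Icc ε (1 - ε)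

/-- Marginal `c`-dependence of the law `P` of `(Y₁, Y₀, X, W)` with bound functions `cl`, `cu`.
Here `P.snd.snd` is the law of `(X, W)`. -/
structure MarginalCDependence {d : ℕ} (P : Measure (Latent d)) [IsProbabilityMeasure P]
    (cl cu : Cov d → ℝ) : Prop where
  bounds : ∀ᵐ w ∂P.snd.snd.snd,
    0 < cl w ∧ cl w ≤ propensity P.snd.snd 1 w ∧ propensity P.snd.snd 1 w ≤ cu w ∧ cu w < 1
  latent : ∀ a : Fin 2, ∀ᵐ z ∂P,
    latentPropensity P a (outcome a z) z.2.2.2 ∈ Icc (cl z.2.2.2) (cu z.2.2.2)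

/-- Univariate cumulative distribution functions. -/
structure IsCDF (F : ℝ → ℝ) : Prop where
  mono : Monotone F
  right_continuous : ∀ y, ContinuousWithinAt F (Ici y) y
  tendsto_atBot : Tendsto F atBot (𝓝 0)
  tendsto_atTop : Tendsto F atTop (𝓝 1)

/-- Bivariate copulas; only the values on the unit square matter. -/
structure IsCopula (C : ℝ → ℝ → ℝ) : Prop where
  zero_left : ∀ v ∈ Icc (0 : ℝ) 1, C 0 v = 0
  zero_right : ∀ u ∈ Icc (0 : ℝ) 1, C u 0 = 0
  one_left : ∀ v ∈ Icc (0 : ℝ) 1, C 1 v = v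
  one_right : ∀ u ∈ Icc (0 : ℝ) 1, C u 1 = u
  two_increasing : ∀ u ∈ Icc (0 : ℝ) 1, ∀ u' ∈ Icc (0 : ℝ) 1, ∀ v ∈ Icc (0 : ℝ) 1,
    ∀ v' ∈ Icc (0 : ℝ) 1, u ≤ u' → v ≤ v' → 0 ≤ C u' v' - C u' v - C u v' + C u v

/-- Families `F(· | x, w)` of functions of one real variable. -/
abbrev CDFFamily (d : ℕ) : Type := Fin 2 → Cov d → ℝ → ℝ

/-- Families `C(·, · | x, w)` of functions of two real variables. -/
abbrev CopulaFamily (d : ℕ) : Type := Fin 2 → Cov d → ℝ → ℝ → ℝ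

/-- The identified set for `(F_{Y₁|X,W}, F_{Y₀|X,W}, C_{1,0|X,W})` under marginal `c`-dependence,
when the observables have law `Q`: the families of cdfs and copulas `(F₁, F₀, C)` such that, for
some law `P` of `(Y₁, Y₀, X, W)` with the observed law of `(X, W)`, the conditional cdfs of `Y₁`
and `Y₀` given `(X, W)` are `F₁` and `F₀` and their joint conditional cdf is `C(F₁, F₀)`, which are
compatible with `Q` and satisfy marginal `c`-dependence. -/
def identifiedSetMarg {d : ℕ} (Q : Measure (Observed d)) [IsProbabilityMeasure Q]
    (cl cu : Cov d → ℝ) : Set (CDFFamily d × CDFFamily d × CopulaFamily d) :=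
  {T | (∀ x w, IsCDF (T.1 x w)) ∧ (∀ x w, IsCDF (T.2.1 x w)) ∧ (∀ x w, IsCopula (T.2.2 x w)) ∧
    ∃ P : ProbabilityMeasure (Latent d),
      (P : Measure (Latent d)).snd.snd = Q.snd ∧
      (∀ᵐ v ∂Q.snd, ∀ y, outcomeCDF (P : Measure (Latent d)) 1 v.1 v.2 y = T.1 v.1 v.2 y) ∧
      (∀ᵐ v ∂Q.snd, ∀ y, outcomeCDF (P : Measure (Latent d)) 0 v.1 v.2 y = T.2.1 v.1 v.2 y) ∧
      (∀ᵐ v ∂Q.snd, ∀ y₁ y₀, jointOutcomeCDF (P : Measure (Latent d)) v.1 v.2 y₁ y₀ =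
        T.2.2 v.1 v.2 (T.1 v.1 v.2 y₁) (T.2.1 v.1 v.2 y₀)) ∧
      (∀ᵐ w ∂Q.snd.snd, ∀ y, T.1 1 w y = observedCDF Q 1 w y) ∧
      (∀ᵐ w ∂Q.snd.snd, ∀ y, T.2.1 0 w y = observedCDF Q 0 w y) ∧
      MarginalCDependence (P : Measure (Latent d)) cl cu}

/-- The functional `θ_CDF(F₁, F₀, C, F_{Y,X,W}; y₁, y₀)`, which expresses `F_{Y₁,Y₀}(y₁, y₀)`. -/
noncomputable def thetaCDF {d : ℕ} (F₁ F₀ : CDFFamily d) (C : CopulaFamily d)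
    (Q : Measure (Observed d)) [IsProbabilityMeasure Q] (y₁ y₀ : ℝ) : ℝ :=
  ∑ x : Fin 2, ∫ w, C x w (F₁ x w y₁) (F₀ x w y₀) * propensity Q.snd x w ∂Q.snd.snd

/-- The identified set for `F_{Y₁,Y₀}(y₁, y₀)` under marginal `c`-dependence. -/
def jointCDFIdentifiedSet {d : ℕ} (Q : Measure (Observed d)) [IsProbabilityMeasure Q]
    (cl cu : Cov d → ℝ) (y₁ y₀ : ℝ) : Set ℝ :=
  (fun T => thetaCDF T.1 T.2.1 T.2.2 Q y₁ y₀) '' identifiedSetMarg Q cl cu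

section Bounds

variable {d : ℕ} (Q : Measure (Observed d)) [IsProbabilityMeasure Q] (cl cu : Cov d → ℝ)
  (x : Fin 2) (w : Cov d) (y : ℝ)

/-- The lower bound on `F_{Y₁|X,W}(y | x, w)`. -/
noncomputable def lowerF₁ : ℝ :=
  let p₁ := propensity Q.snd 1 w
  let p₀ := propensity Q.snd 0 w
  let F := observedCDF Q 1 w y
  if x = 1 then F else
    max (F * (p₁ * (1 - cu w) / (p₀ * cu w)))
      ((cl w - p₁) / (cl w * p₀) + F * (p₁ * (1 - cl w) / (p₀ * cl w)))

/-- The upper bound on `F_{Y₁|X,W}(y | x, w)`. -/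
noncomputable def upperF₁ : ℝ :=
  let p₁ := propensity Q.snd 1 w
  let p₀ := propensity Q.snd 0 w
  let F := observedCDF Q 1 w y
  if x = 1 then F else
    min (F * (p₁ * (1 - cl w) / (p₀ * cl w)))
      ((cu w - p₁) / (cu w * p₀) + F * (p₁ * (1 - cu w) / (p₀ * cu w)))

/-- The lower bound on `F_{Y₀|X,W}(y | x, w)`. -/
noncomputable def lowerF₀ : ℝ :=
  let p₁ := propensity Q.snd 1 w
  let p₀ := propensity Q.snd 0 w
  let F := observedCDF Q 0 w y
  if x = 0 then F else
    max (F * (p₀ * cl w / (p₁ * (1 - cl w))))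
      ((p₁ - cu w) / ((1 - cu w) * p₁) + F * (p₀ * cu w / (p₁ * (1 - cu w))))

/-- The upper bound on `F_{Y₀|X,W}(y | x, w)`. -/
noncomputable def upperF₀ : ℝ :=
  let p₁ := propensity Q.snd 1 w
  let p₀ := propensity Q.snd 0 w
  let F := observedCDF Q 0 w y
  if x = 0 then F else
    min (F * (p₀ * cu w / (p₁ * (1 - cu w))))
      ((p₁ - cl w) / ((1 - cl w) * p₁) + F * (p₀ * cl w / (p₁ * (1 - cl w))))

end Bounds

/-! Given `W = w`, Bayes' rule turns the bounds on `P(X = 1 | Y_a, W)` into a domination of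
measures: the law of `Y_a` in the unobserved arm `X ≠ a` lies between `α` and `β` times its law in
the observed arm `X = a`, where `α ≤ 1 ≤ β` are `slopeLower` and `slopeUpper`
(`PropensityBounds.slope_bounds_iff`).

Outer bounds: if `G` is the observed cdf, testing this domination on a half-line and on its
complement puts the unobserved cdf between `max (α G) (1 - β (1 - G))` and `min (β G) (1 - α (1 -
G))` (`MarginalCDependence.outcomeCDF_mem`). These are the stated bounds in another form. Any copula
lies between the Fréchet–Hoeffding bounds, which are monotone in the marginals, so integrating over
`(X, W)` confines the functional to the interval.

Sharpness: a single parameter `t ∈ [0, 1]` moves both unobserved cdfs and the copula from their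
lower to their upper extremes. Each intermediate triple belongs to the identified set
(`interpolated_mem_identifiedSetMarg`): the interpolated cdf is a function of `G` with slopes in
`[α, β]`, which gives back the domination of measures, and the mixed copula comes from a quantile
coupling (`exists_coupling_frechetCopula`). The functional is continuous in `t` by dominated
convergence and attains both endpoints, so the intermediate value theorem fills the interval. -/

/-! ### Copulas -/

/-- The mixture of the two Fréchet–Hoeffding copulas with weight `t` on the upper one. -/
noncomputable def frechetCopula (t u v : ℝ) : ℝ := (1 - t) * max (u + v - 1) 0 + t * min u v

theorem isCopula_frechetCopula {t : ℝ} (ht : t ∈ Icc (0 : ℝ) 1) : IsCopula (frechetCopula t) where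
  zero_left v hv := by
    simp [frechetCopula, max_eq_right (sub_nonpos.2 hv.2), min_eq_left hv.1]
  zero_right u hu := by
    simp [frechetCopula, max_eq_right (sub_nonpos.2 hu.2), min_eq_right hu.1]
  one_left v hv := by
    simp only [frechetCopula, add_sub_cancel_left, max_eq_left hv.1, min_eq_right hv.2]; ring
  one_right u hu := by
    simp only [frechetCopula, add_sub_cancel_right, max_eq_left hu.1, min_eq_left hu.2]; ring
  two_increasing u _ u' _ v _ v' _ huu hvv := by
    have h₁ : 0 ≤ max (u' + v' - 1) 0 - max (u' + v - 1) 0 - max (u + v' - 1) 0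
        + max (u + v - 1) 0 := by
      rcases le_total (u' + v' - 1) 0 with h1 | h1 <;> rcases le_total (u' + v - 1) 0 with h2 | h2 <;>
      rcases le_total (u + v' - 1) 0 with h3 | h3 <;> rcases le_total (u + v - 1) 0 with h4 | h4 <;>
      simp only [h1, h2, h3, h4, max_eq_left, max_eq_right] <;> linarith
    have h₂ : 0 ≤ min u' v' - min u' v - min u v' + min u v := by
      rcases le_total u' v' with h1 | h1 <;> rcases le_total u' v with h2 | h2 <;>
      rcases le_total u v' with h3 | h3 <;> rcases le_total u v with h4 | h4 <;>
      simp only [h1, h2, h3, h4, min_eq_left, min_eq_right] <;> linarith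
    have := add_nonneg (mul_nonneg (sub_nonneg.2 ht.2) h₁) (mul_nonneg ht.1 h₂)
    simp only [frechetCopula]
    linarith

/-- The rectangles `[u, 1] × [0, v]` and `[0, u] × [v, 1]` have nonnegative `C`-volume, namely `v -
C u v` and `u - C u v`. -/
theorem IsCopula.le_min {C : ℝ → ℝ → ℝ} (hC : IsCopula C) {u v : ℝ} (hu : u ∈ Icc (0 : ℝ) 1)
    (hv : v ∈ Icc (0 : ℝ) 1) : C u v ≤ min u v := by
  have h0 : (0 : ℝ) ∈ Icc (0 : ℝ) 1 := by simp
  have h1 : (1 : ℝ) ∈ Icc (0 : ℝ) 1 := by simp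
  have a := hC.two_increasing u hu 1 h1 0 h0 v hv hu.2 hv.1
  have b := hC.two_increasing 0 h0 u hu v hv 1 h1 hu.1 hv.2
  rw [hC.one_left v hv, hC.zero_right u hu, hC.zero_right 1 h1] at a
  rw [hC.one_right u hu, hC.zero_left v hv, hC.zero_left 1 h1] at b
  exact _root_.le_min (by linarith) (by linarith)

/-- Same argument with the rectangles `[u, 1] × [v, 1]` and `[0, u] × [0, v]`. -/
theorem IsCopula.max_le {C : ℝ → ℝ → ℝ} (hC : IsCopula C) {u v : ℝ} (hu : u ∈ Icc (0 : ℝ) 1)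
    (hv : v ∈ Icc (0 : ℝ) 1) : max (u + v - 1) 0 ≤ C u v := by
  have h0 : (0 : ℝ) ∈ Icc (0 : ℝ) 1 := by simp
  have h1 : (1 : ℝ) ∈ Icc (0 : ℝ) 1 := by simp
  have a := hC.two_increasing u hu 1 h1 v hv 1 h1 hu.2 hv.2
  have b := hC.two_increasing 0 h0 u hu 0 h0 v hv hu.1 hv.1
  rw [hC.one_left v hv, hC.one_right u hu, hC.one_left 1 h1] at a
  rw [hC.zero_right u hu, hC.zero_left v hv, hC.zero_left 0 h0] at b
  exact _root_.max_le (by linarith) (by linarith)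

/-! ### Distribution functions with bounded relative density -/

/-- Interpolation between the smallest (`t = 0`) and the largest (`t = 1`) value at `g` of a
distribution function on `[0, 1]` with slopes in `[a, b]`. -/
noncomputable def distort (a b t g : ℝ) : ℝ :=
  (1 - t) * max (a * g) (1 - b * (1 - g)) + t * min (b * g) (1 - a * (1 - g))

section Distort

variable {a b t : ℝ}

theorem distort_zero (ha : a ≤ 1) (hb : 1 ≤ b) : distort a b t 0 = 0 := by
  have h1 : max (a * 0) (1 - b * (1 - 0)) = 0 := by simp [hb]
  have h2 : min (b * 0) (1 - a * (1 - 0)) = 0 := by simp [ha]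
  rw [distort, h1, h2]; ring

theorem distort_one (ha : a ≤ 1) (hb : 1 ≤ b) : distort a b t 1 = 1 := by
  have h1 : max (a * 1) (1 - b * (1 - 1)) = 1 := by simp [ha]
  have h2 : min (b * 1) (1 - a * (1 - 1)) = 1 := by simp [hb]
  rw [distort, h1, h2]; ring

theorem continuous_distort : Continuous (distort a b t) := by
  unfold distort; fun_prop

/-- A maximum or minimum of two affine functions with slopes `a` and `b` has all its chord slopes in
`[a, b]`, and this interval is convex, so mixing with weight `t` preserves the property. -/
theorem distort_sub_mem (hab : a ≤ b) (ht : t ∈ Icc (0 : ℝ) 1) {g g' : ℝ} (h : g ≤ g') :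
    distort a b t g' - distort a b t g ∈ Icc (a * (g' - g)) (b * (g' - g)) := by
  have hd : a * (g' - g) ≤ b * (g' - g) := mul_le_mul_of_nonneg_right hab (sub_nonneg.2 h)
  have h1 : max (a * g') (1 - b * (1 - g')) - max (a * g) (1 - b * (1 - g)) ∈
      Icc (a * (g' - g)) (b * (g' - g)) := by
    constructor
    · rcases max_choice (a * g) (1 - b * (1 - g)) with e | e <;> rw [e]
      · linarith [le_max_left (a * g') (1 - b * (1 - g'))]
      · linarith [le_max_right (a * g') (1 - b * (1 - g'))]
    · rcases max_choice (a * g') (1 - b * (1 - g')) with e | e <;> rw [e]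
      · linarith [le_max_left (a * g) (1 - b * (1 - g))]
      · linarith [le_max_right (a * g) (1 - b * (1 - g))]
  have h2 : min (b * g') (1 - a * (1 - g')) - min (b * g) (1 - a * (1 - g)) ∈
      Icc (a * (g' - g)) (b * (g' - g)) := by
    constructor
    · rcases min_choice (b * g') (1 - a * (1 - g')) with e | e <;> rw [e]
      · linarith [min_le_left (b * g) (1 - a * (1 - g))]
      · linarith [min_le_right (b * g) (1 - a * (1 - g))]
    · rcases min_choice (b * g) (1 - a * (1 - g)) with e | e <;> rw [e]
      · linarith [min_le_left (b * g') (1 - a * (1 - g'))]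
      · linarith [min_le_right (b * g') (1 - a * (1 - g'))]
  have := convex_Icc (a * (g' - g)) (b * (g' - g)) h1 h2 (sub_nonneg.2 ht.2) ht.1 (by ring)
  convert this using 1
  simp only [distort, smul_eq_mul]
  ring

end Distort

namespace IsCDF

variable {F : ℝ → ℝ}

theorem nonneg (hF : IsCDF F) (y : ℝ) : 0 ≤ F y := hF.mono.le_of_tendsto hF.tendsto_atBot y

theorem le_one (hF : IsCDF F) (y : ℝ) : F y ≤ 1 := hF.mono.ge_of_tendsto hF.tendsto_atTop y

theorem mem_Icc (hF : IsCDF F) (y : ℝ) : F y ∈ Icc (0 : ℝ) 1 := ⟨hF.nonneg y, hF.le_one y⟩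

theorem distort_comp (hF : IsCDF F) {a b t : ℝ} (ha₀ : 0 ≤ a) (ha : a ≤ 1) (hb : 1 ≤ b)
    (ht : t ∈ Icc (0 : ℝ) 1) : IsCDF fun y => distort a b t (F y) where
  mono y y' h := by
    have h' := hF.mono h
    have := (distort_sub_mem (ha.trans hb) ht h').1
    have := mul_nonneg ha₀ (sub_nonneg.2 h')
    show distort a b t (F y) ≤ distort a b t (F y')
    linarith
  right_continuous y := continuous_distort.continuousAt.comp_continuousWithinAt
    (hF.right_continuous y)
  tendsto_atBot := by
    rw [← distort_zero (t := t) ha hb]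
    exact (continuous_distort.tendsto _).comp
      hF.tendsto_atBot
  tendsto_atTop := by
    rw [← distort_one (t := t) ha hb]
    exact (continuous_distort.tendsto _).comp
      hF.tendsto_atTop

end IsCDF

theorem isCDF_measureReal_Iic (μ : Measure ℝ) [IsProbabilityMeasure μ] :
    IsCDF fun y => μ.real (Iic y) := by
  simp_rw [← cdf_eq_real]
  exact ⟨monotone_cdf μ, (cdf μ).right_continuous, tendsto_cdf_atBot μ, tendsto_cdf_atTop μ⟩

open scoped NNReal in
-- The difference of the scaled cdfs is itself a Stieltjes function, and its measure is exactly what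
-- must be added to `c' • ν` to obtain `c • μ`.
theorem measure_le_smul_of_monotone_sub {μ ν : Measure ℝ} [IsProbabilityMeasure μ]
    [IsProbabilityMeasure ν] {c c' : ℝ≥0}
    (h : Monotone fun y => c * μ.real (Iic y) - c' * ν.real (Iic y)) : c' • ν ≤ c • μ := by
  simp_rw [← cdf_eq_real] at h
  let f : StieltjesFunction ℝ := ⟨_, h, fun y =>
    (continuousWithinAt_const.mul ((cdf μ).right_continuous y)).sub
      (continuousWithinAt_const.mul ((cdf ν).right_continuous y))⟩
  have hf : c' • cdf ν + f = c • cdf μ := by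
    ext y
    show c' * cdf ν y + (c * cdf μ y - c' * cdf ν y) = c * cdf μ y
    ring
  have hadd := StieltjesFunction.measure_add (c' • cdf ν) f
  rw [hf, StieltjesFunction.measure_smul, StieltjesFunction.measure_smul, measure_cdf,
    measure_cdf] at hadd
  rw [hadd]
  exact Measure.le_add_right le_rfl

/-! ### Quantile functions and couplings -/

/-- The quantile function of `F`, set to zero outside the open unit interval. -/
noncomputable def quantile (F : ℝ → ℝ) (u : ℝ) : ℝ :=
  open scoped Classical in if u ∈ Ioo (0 : ℝ) 1 then sInf {y | u ≤ F y} else 0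

theorem IsCDF.quantile_le_iff {F : ℝ → ℝ} (hF : IsCDF F) {u : ℝ} (hu : u ∈ Ioo (0 : ℝ) 1) (y : ℝ) :
    quantile F u ≤ y ↔ u ≤ F y := by
  rw [quantile, if_pos hu]
  have hne : {y | u ≤ F y}.Nonempty :=
    (hF.tendsto_atTop.eventually (eventually_gt_nhds hu.2)).exists.imp fun _ h => le_of_lt h
  obtain ⟨l, hl⟩ := (hF.tendsto_atBot.eventually (eventually_lt_nhds hu.1)).exists
  have hbdd : BddBelow {y | u ≤ F y} :=
    ⟨l, fun z hz => le_of_not_gt fun h => absurd (hF.mono h.le) (not_le.2 (hl.trans_le hz))⟩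
  refine ⟨fun h => ?_, fun h => csInf_le hbdd h⟩
  -- Right continuity makes the infimum belong to the set.
  have hlim : Tendsto F (𝓝[>] sInf {y | u ≤ F y}) (𝓝 (F (sInf {y | u ≤ F y}))) :=
    (hF.right_continuous _).mono Ioi_subset_Ici_self
  refine (ge_of_tendsto hlim ?_).trans (hF.mono h)
  filter_upwards [self_mem_nhdsWithin] with z hz
  obtain ⟨z', hz', hzz⟩ := exists_lt_of_csInf_lt hne hz
  exact le_trans hz' (hF.mono hzz.le)

theorem measurable_quantile {V : Type*} [MeasurableSpace V] {F : V → ℝ → ℝ}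
    (hF : ∀ v, IsCDF (F v)) (hm : ∀ y, Measurable fun v => F v y) :
    Measurable fun p : V × ℝ => quantile (F p.1) p.2 := by
  refine measurable_of_Iic fun y => ?_
  have hu : MeasurableSet {p : V × ℝ | p.2 ∈ Ioo (0 : ℝ) 1} := measurable_snd measurableSet_Ioo
  have hle : MeasurableSet {p : V × ℝ | p.2 ≤ F p.1 y} :=
    measurableSet_le measurable_snd ((hm y).comp measurable_fst)
  convert hu.ite hle (MeasurableSet.const (0 ≤ y)) using 1
  ext p
  by_cases h : p.2 ∈ Ioo (0 : ℝ) 1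
  · simpa [Set.ite, h.1, h.2] using (hF p.1).quantile_le_iff h y
  · have : quantile (F p.1) p.2 = 0 := if_neg h
    simp only [Set.ite, mem_preimage, this, mem_Iic, mem_union, mem_inter_iff, mem_ofPred_eq, h,
      Set.mem_sdiff, and_false, not_false_eq_true, and_true, false_or]

/-- The uniform distribution on the open unit interval. -/
noncomputable def uniform01 : Measure ℝ := volume.restrict (Ioo 0 1)

instance : IsProbabilityMeasure uniform01 := ⟨by simp [uniform01]⟩

theorem uniform01_eq_ofReal {S : Set ℝ} {a b : ℝ} (ha : 0 ≤ a) (hb : b ≤ 1)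
    (h : ∀ u ∈ Ioo (0 : ℝ) 1, u ∈ S ↔ a ≤ u ∧ u ≤ b) : uniform01 S = ENNReal.ofReal (b - a) := by
  have hS : uniform01 S = uniform01 (Icc a b) := by
    refine measure_congr ?_
    filter_upwards [ae_restrict_mem measurableSet_Ioo] with u hu
    exact propext (h u hu)
  -- The case `b < a` is allowed: the interval is then empty and `ENNReal.ofReal` truncates to zero.
  rw [hS, uniform01, Measure.restrict_congr_set Ioo_ae_eq_Icc, Measure.restrict_apply measurableSet_Icc,
    inter_eq_left.2 (Icc_subset_Icc ha hb), Real.volume_Icc]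

section Coupling

variable {V : Type*} [MeasurableSpace V]

/-- The kernel `v ↦ law of f (v, U)` with `U` uniform. -/
noncomputable def uniformKernel {β : Type*} [MeasurableSpace β] (f : V × ℝ → β)
    (hf : Measurable f) : Kernel V β where
  toFun v := uniform01.map fun u => f (v, u)
  measurable' := by
    refine Measure.measurable_of_measurable_coe _ fun s hs => ?_
    have : ∀ v, uniform01.map (fun u => f (v, u)) s = uniform01 (Prod.mk v ⁻¹' (f ⁻¹' s)) :=
      fun v => Measure.map_apply (hf.comp measurable_prodMk_left) hs
    simp_rw [this]
    exact measurable_measure_prodMk_left (hf hs)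

/-- The kernel `v ↦ (1 - t) κ v + t η v`. -/
noncomputable def mixKernel {β : Type*} [MeasurableSpace β] (κ η : Kernel V β) (t : ℝ) :
    Kernel V β where
  toFun v := ENNReal.ofReal (1 - t) • κ v + ENNReal.ofReal t • η v
  measurable' := by
    refine Measure.measurable_of_measurable_coe _ fun s hs => ?_
    simp only [Measure.coe_add, Measure.coe_smul, Pi.add_apply, Pi.smul_apply, smul_eq_mul]
    exact ((κ.measurable_coe hs).const_mul _).add ((η.measurable_coe hs).const_mul _)

theorem isMarkovKernel_mixKernel {β : Type*} [MeasurableSpace β] (κ η : Kernel V β)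
    [IsMarkovKernel κ] [IsMarkovKernel η] {t : ℝ} (ht : t ∈ Icc (0 : ℝ) 1) :
    IsMarkovKernel (mixKernel κ η t) := by
  refine ⟨fun v => ⟨?_⟩⟩
  show ENNReal.ofReal (1 - t) * κ v univ + ENNReal.ofReal t * η v univ = 1
  rw [measure_univ, measure_univ, mul_one, mul_one, ← ENNReal.ofReal_add (sub_nonneg.2 ht.2) ht.1]
  simp

theorem mixKernel_real {β : Type*} [MeasurableSpace β] (κ η : Kernel V β) {t : ℝ}
    (ht : t ∈ Icc (0 : ℝ) 1) (v : V) (s : Set β) {x y : ℝ} (hx : 0 ≤ x) (hy : 0 ≤ y)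
    (hκ : κ v s = ENNReal.ofReal x) (hη : η v s = ENNReal.ofReal y) :
    (mixKernel κ η t v).real s = (1 - t) * x + t * y := by
  have : mixKernel κ η t v s = ENNReal.ofReal (1 - t) * κ v s + ENNReal.ofReal t * η v s := rfl
  have ht' := sub_nonneg.2 ht.2
  rw [measureReal_def, this, hκ, hη, ← ENNReal.ofReal_mul ht', ← ENNReal.ofReal_mul ht.1,
    ← ENNReal.ofReal_add (mul_nonneg ht' hx) (mul_nonneg ht.1 hy),
    ENNReal.toReal_ofReal (add_nonneg (mul_nonneg ht' hx) (mul_nonneg ht.1 hy))]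

/-- For `U` uniform, feeding `(1 - U, U)` to the two quantile functions realizes the lower
Fréchet–Hoeffding copula and `(U, U)` the upper one. Mixing the two kernels leaves the marginals
unchanged. -/
theorem exists_coupling_frechetCopula {F₁ F₀ : V → ℝ → ℝ} (h₁ : ∀ v, IsCDF (F₁ v))
    (h₀ : ∀ v, IsCDF (F₀ v)) (hm₁ : ∀ y, Measurable fun v => F₁ v y)
    (hm₀ : ∀ y, Measurable fun v => F₀ v y) {t : ℝ} (ht : t ∈ Icc (0 : ℝ) 1) :
    ∃ κ : Kernel V (ℝ × ℝ), IsMarkovKernel κ ∧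
      (∀ v y₁ y₀, (κ v).real (Iic y₁ ×ˢ Iic y₀) = frechetCopula t (F₁ v y₁) (F₀ v y₀)) ∧
      (∀ v y, (κ v).real (Prod.fst ⁻¹' Iic y) = F₁ v y) ∧
      (∀ v y, (κ v).real (Prod.snd ⁻¹' Iic y) = F₀ v y) := by
  have hq₁ := measurable_quantile h₁ hm₁
  have hq₀ := measurable_quantile h₀ hm₀
  have hq₁' : Measurable fun p : V × ℝ => quantile (F₁ p.1) (1 - p.2) :=
    hq₁.comp (f := fun p : V × ℝ => (p.1, 1 - p.2)) (by fun_prop)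
  have hanti := hq₁'.prodMk hq₀
  have hco := hq₁.prodMk hq₀
  have hval : ∀ {f : V × ℝ → ℝ × ℝ} (hf : Measurable f) (v : V) {s : Set (ℝ × ℝ)}
      (_ : MeasurableSet s) {a b : ℝ}, 0 ≤ a → b ≤ 1 →
      (∀ u ∈ Ioo (0 : ℝ) 1, f (v, u) ∈ s ↔ a ≤ u ∧ u ≤ b) →
      uniformKernel f hf v s = ENNReal.ofReal (b - a) := by
    intro f hf v s hs a b ha hb h
    refine (Measure.map_apply (hf.comp measurable_prodMk_left) hs).trans ?_
    exact uniform01_eq_ofReal ha hb h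
  have hmk : ∀ {f : V × ℝ → ℝ × ℝ} (hf : Measurable f), IsMarkovKernel (uniformKernel f hf) :=
    fun hf => ⟨fun v => Measure.isProbabilityMeasure_map
      (hf.comp measurable_prodMk_left).aemeasurable⟩
  have := hmk hanti
  have := hmk hco
  have hsymm : ∀ {u : ℝ}, u ∈ Ioo (0 : ℝ) 1 → 1 - u ∈ Ioo (0 : ℝ) 1 :=
    fun hu => ⟨by linarith [hu.2], by linarith [hu.1]⟩
  refine ⟨mixKernel (uniformKernel _ hanti) (uniformKernel _ hco) t,
    isMarkovKernel_mixKernel _ _ ht, fun v y₁ y₀ => ?_, fun v y => ?_, fun v y => ?_⟩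
  · have hs : MeasurableSet (Iic y₁ ×ˢ Iic y₀) := measurableSet_Iic.prod measurableSet_Iic
    refine mixKernel_real _ _ ht v _ (le_max_right _ _)
      (le_min ((h₁ v).nonneg y₁) ((h₀ v).nonneg y₀)) ?_ ?_
    -- The event is `1 - F₁ ≤ u ≤ F₀`; truncation of its possibly negative length produces the
    -- maximum with zero.
    · rw [hval hanti v hs (a := 1 - F₁ v y₁) (b := F₀ v y₀) (by linarith [(h₁ v).le_one y₁])
        ((h₀ v).le_one _)]
      · rw [ENNReal.ofReal_max, ENNReal.ofReal_zero, max_eq_left zero_le]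
        congr 1; ring
      · intro u hu
        simp only [mem_prod, mem_Iic, (h₁ v).quantile_le_iff (hsymm hu),
          (h₀ v).quantile_le_iff hu, sub_le_comm]
    · rw [hval hco v hs (a := 0) (b := min (F₁ v y₁) (F₀ v y₀)) le_rfl
        (min_le_of_left_le ((h₁ v).le_one _)), sub_zero]
      intro u hu
      simp only [mem_prod, mem_Iic, (h₁ v).quantile_le_iff hu, (h₀ v).quantile_le_iff hu,
        le_min_iff, hu.1.le, true_and]
  · have hs : MeasurableSet (Prod.fst ⁻¹' Iic y : Set (ℝ × ℝ)) := measurable_fst measurableSet_Iic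
    rw [mixKernel_real _ _ ht v _ ((h₁ v).nonneg y) ((h₁ v).nonneg y)]
    · ring
    · rw [hval hanti v hs (a := 1 - F₁ v y) (b := 1) (by linarith [(h₁ v).le_one y]) le_rfl]
      · congr 1; ring
      · intro u hu
        simp only [mem_preimage, mem_Iic, (h₁ v).quantile_le_iff (hsymm hu), hu.2.le, and_true,
          sub_le_comm]
    · rw [hval hco v hs (a := 0) (b := F₁ v y) le_rfl ((h₁ v).le_one _), sub_zero]
      intro u hu
      simp only [mem_preimage, mem_Iic, (h₁ v).quantile_le_iff hu, hu.1.le, true_and]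
  · have hs : MeasurableSet (Prod.snd ⁻¹' Iic y : Set (ℝ × ℝ)) := measurable_snd measurableSet_Iic
    rw [mixKernel_real _ _ ht v _ ((h₀ v).nonneg y) ((h₀ v).nonneg y)]
    · ring
    all_goals
      rw [hval _ v hs (a := 0) (b := F₀ v y) le_rfl ((h₀ v).le_one _), sub_zero]
      intro u hu
      simp only [mem_preimage, mem_Iic, (h₀ v).quantile_le_iff hu, hu.1.le, true_and]

end Coupling

/-! ### Latent laws with a prescribed conditional law of the outcomes -/

section LatentLaw

variable {d : ℕ}

theorem measurable_outcome (a : Fin 2) : Measurable (outcome (d := d) a) := by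
  unfold outcome; split_ifs <;> fun_prop

/-- The law of `(Y₁, Y₀, X, W)` when `(X, W)` has law `ρ` and `κ` is the conditional law of
`(Y₁, Y₀)` given `(X, W)`. -/
noncomputable def latentLaw (ρ : Measure (Fin 2 × Cov d)) (κ : Kernel (Fin 2 × Cov d) (ℝ × ℝ)) :
    Measure (Latent d) :=
  (ρ ⊗ₘ κ).map fun p => (p.2.1, p.2.2, p.1)

variable {ρ : Measure (Fin 2 × Cov d)} [IsProbabilityMeasure ρ]
  {κ : Kernel (Fin 2 × Cov d) (ℝ × ℝ)} [IsMarkovKernel κ]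

instance : IsProbabilityMeasure (latentLaw ρ κ) :=
  Measure.isProbabilityMeasure_map (by fun_prop)

theorem latentLaw_map_covariates : (latentLaw ρ κ).map (fun z => z.2.2) = ρ := by
  rw [latentLaw, Measure.map_map (by fun_prop) (by fun_prop)]
  exact Measure.fst_compProd ρ κ

theorem latentLaw_snd_snd : (latentLaw ρ κ).snd.snd = ρ := by
  rw [Measure.snd, Measure.snd, Measure.map_map measurable_snd measurable_snd]
  exact latentLaw_map_covariates

theorem condDistrib_latentLaw :
    condDistrib (fun z : Latent d => (z.1, z.2.1)) (fun z : Latent d => z.2.2) (latentLaw ρ κ)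
      =ᵐ[ρ] κ := by
  have := condDistrib_ae_eq_of_measure_eq_compProd (μ := latentLaw ρ κ)
    (Y := fun z : Latent d => (z.1, z.2.1)) (κ := κ)
    (fun z : Latent d => z.2.2) (by fun_prop) (by
      rw [latentLaw_map_covariates, latentLaw, Measure.map_map (by fun_prop) (by fun_prop)]
      exact Measure.map_id)
  rwa [latentLaw_map_covariates] at this

theorem condDistrib_outcome_latentLaw (a : Fin 2) :
    condDistrib (outcome a) (fun z : Latent d => z.2.2) (latentLaw ρ κ)
      =ᵐ[ρ] κ.map (if a = 1 then Prod.fst else Prod.snd) := by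
  have hf : Measurable (if a = 1 then Prod.fst else Prod.snd : ℝ × ℝ → ℝ) := by
    split_ifs <;> fun_prop
  have h := condDistrib_comp (mβ := inferInstance) (μ := latentLaw ρ κ) (fun z : Latent d => z.2.2)
    (Y := fun z : Latent d => (z.1, z.2.1)) (by fun_prop) hf
  rw [latentLaw_map_covariates] at h
  have ho : (if a = 1 then Prod.fst else Prod.snd : ℝ × ℝ → ℝ) ∘
      (fun z : Latent d => (z.1, z.2.1)) = outcome a := by
    funext z; simp only [outcome, Function.comp]; split_ifs <;> rfl
  rw [ho] at h
  filter_upwards [h, condDistrib_latentLaw (ρ := ρ) (κ := κ)] with v hv hv'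
  rw [hv, Kernel.map_apply _ hf, Kernel.map_apply _ hf, hv']

end LatentLaw

/-! ### Propensities -/

section Propensity

variable {d : ℕ} (ρ : Measure (Fin 2 × Cov d)) [IsProbabilityMeasure ρ]

theorem measurable_propensity (x : Fin 2) : Measurable (propensity ρ x) :=
  ((condDistrib Prod.fst Prod.snd ρ).measurable_coe (measurableSet_singleton x)).ennreal_toReal

theorem propensity_nonneg (x : Fin 2) (w : Cov d) : 0 ≤ propensity ρ x w := measureReal_nonneg

theorem propensity_zero (w : Cov d) : propensity ρ 0 w = 1 - propensity ρ 1 w := by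
  have h : ({0} : Set (Fin 2)) = {1}ᶜ := by ext x; fin_cases x <;> simp
  rw [propensity, propensity, h, probReal_compl_eq_one_sub (measurableSet_singleton _)]

theorem lintegral_eq_sum_propensity {f : Fin 2 × Cov d → ENNReal} (hf : Measurable f) :
    ∫⁻ v, f v ∂ρ = ∫⁻ w, ∑ x, ENNReal.ofReal (propensity ρ x w) * f (x, w) ∂ρ.snd := by
  have h := compProd_map_condDistrib (mβ := inferInstance) (X := (Prod.snd : Fin 2 × Cov d → Cov d)) (μ := ρ)
    (Y := Prod.fst) measurable_fst.aemeasurable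
  have hf' : Measurable fun p : Cov d × Fin 2 => f p.swap := hf.comp measurable_swap
  have h' : ∫⁻ v, f v ∂ρ =
      ∫⁻ p : Cov d × Fin 2, f p.swap ∂(ρ.map fun v => (v.2, v.1)) := by
    rw [lintegral_map hf' (by fun_prop)]
    rfl
  rw [h', ← h, Measure.lintegral_compProd hf']
  refine lintegral_congr fun w => ?_
  rw [lintegral_fintype]
  refine Finset.sum_congr rfl fun x _ => ?_
  rw [propensity, ofReal_measureReal, mul_comm]
  rfl

/-- When both arms have positive conditional mass, a set is null for `(X, W)` only if each of its
slices is null for `W`. This lets statements at `(X, W)` be evaluated at both arms for the same `w`,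
as comparing the arms requires. -/
theorem ae_iff_forall_ae_of_propensity_pos (hpos : ∀ᵐ w ∂ρ.snd, ∀ x, 0 < propensity ρ x w)
    {p : Fin 2 × Cov d → Prop} : (∀ᵐ v ∂ρ, p v) ↔ ∀ x, ∀ᵐ w ∂ρ.snd, p (x, w) := by
  constructor
  · intro h x
    obtain ⟨s, hs, hms, hs0⟩ := exists_measurable_superset_of_null (ae_iff.1 h)
    have hf : Measurable (s.indicator (1 : Fin 2 × Cov d → ENNReal)) :=
      measurable_one.indicator hms
    have h0 := lintegral_eq_sum_propensity ρ hf
    rw [lintegral_indicator_one hms, hs0, eq_comm, lintegral_eq_zero_iff] at h0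
    · filter_upwards [h0, hpos] with w hw hw'
      by_contra hp
      have := (Finset.sum_eq_zero_iff.1 hw) x (Finset.mem_univ _)
      rw [indicator_of_mem (hs hp)] at this
      simp at this
      exact absurd this (not_le.2 (hw' x))
    · exact Finset.measurable_sum _ fun x _ =>
        (measurable_propensity ρ x).ennreal_ofReal.mul (hf.comp measurable_prodMk_left)
  · intro h
    have h' : ∀ᵐ v ∂ρ, ∀ x, p (x, v.2) :=
      ae_of_ae_map (f := Prod.snd) measurable_snd.aemeasurable (ae_all_iff.2 h)
    filter_upwards [h'] with v hv using hv v.1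

theorem integral_eq_sum_propensity {f : Fin 2 × Cov d → ℝ} (hf : Integrable f ρ) :
    ∫ v, f v ∂ρ = ∑ x, ∫ w, f (x, w) * propensity ρ x w ∂ρ.snd := by
  have h := compProd_map_condDistrib (mβ := inferInstance) (X := (Prod.snd : Fin 2 × Cov d → Cov d)) (μ := ρ)
    (Y := Prod.fst) measurable_fst.aemeasurable
  have hmap : ρ = (ρ.map fun v => (v.2, v.1)).map Prod.swap := by
    rw [Measure.map_map measurable_swap (by fun_prop)]
    exact Measure.map_id.symm
  have hint : Integrable (fun p : Cov d × Fin 2 => f p.swap)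
      (ρ.snd ⊗ₘ condDistrib Prod.fst Prod.snd ρ) := by
    rw [Measure.snd, h]
    rw [hmap] at hf
    exact hf.comp_measurable measurable_swap
  have h' : ∫ v, f v ∂ρ =
      ∫ p : Cov d × Fin 2, f p.swap ∂(ρ.snd ⊗ₘ condDistrib Prod.fst Prod.snd ρ) := by
    rw [Measure.snd, h]
    conv_lhs => rw [hmap]
    exact integral_map_equiv MeasurableEquiv.prodComm f
  have hsec : ∀ w, ∫ x, f (x, w) ∂(condDistrib Prod.fst Prod.snd ρ w) =
      ∑ x, f (x, w) * propensity ρ x w := by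
    intro w
    rw [integral_fintype (.of_finite)]
    exact Finset.sum_congr rfl fun x _ => mul_comm _ _
  rw [h', Measure.integral_compProd hint]
  simp only [Prod.swap_prod_mk, hsec]
  refine integral_finsetSum _ fun x _ => ?_
  -- Exchanging sum and integral needs each summand integrable: it is the fibre integral of `f` cut
  -- off to the slice `X = x`.
  have hx : Integrable (fun p : Cov d × Fin 2 => ({x} : Set (Fin 2)).indicator
      (fun _ => f (x, p.1)) p.2) (ρ.snd ⊗ₘ condDistrib Prod.fst Prod.snd ρ) := by
    refine (hint.indicator (s := Prod.snd ⁻¹' {x})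
      (measurable_snd (measurableSet_singleton x))).congr (ae_of_all _ fun p => ?_)
    dsimp only
    by_cases hp : p.2 = x
    · rw [indicator_of_mem (by exact hp), indicator_of_mem (by exact hp)]
      rw [← hp]; rfl
    · rw [indicator_of_notMem (by exact hp), indicator_of_notMem (by exact hp)]
  rw [Measure.compProd] at hx
  refine hx.integral_compProd.congr (ae_of_all _ fun w => ?_)
  show ∫ y, ({x} : Set (Fin 2)).indicator (fun _ => f (x, w)) y ∂(condDistrib Prod.fst Prod.snd ρ w)
    = f (x, w) * propensity ρ x w
  rw [integral_indicator (measurableSet_singleton x), setIntegral_const, smul_eq_mul, mul_comm]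
  rfl

end Propensity

/-! ### Marginal dependence in terms of conditional outcome laws -/

theorem Latent.snd_snd_eq_map {d : ℕ} (P : Measure (Latent d)) : P.snd.snd = P.map fun z => z.2.2 := by
  rw [Measure.snd, Measure.snd, Measure.map_map measurable_snd measurable_snd]
  rfl

section LatentPropensity

variable {d : ℕ} (P : Measure (Latent d)) [IsProbabilityMeasure P]

theorem lintegral_outcome_eq (a : Fin 2) {f : ℝ → Fin 2 → Cov d → ENNReal}
    (hf : Measurable fun p : ℝ × Fin 2 × Cov d => f p.1 p.2.1 p.2.2) :
    ∫⁻ z, f (outcome a z) z.2.2.1 z.2.2.2 ∂P =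
      ∫⁻ w, ∑ x, ENNReal.ofReal (propensity P.snd.snd x w) *
        ∫⁻ y, f y x w ∂(condDistrib (outcome a) (fun z : Latent d => z.2.2) P (x, w))
          ∂P.snd.snd.snd := by
  have h := compProd_map_condDistrib (mβ := inferInstance) (X := fun z : Latent d => z.2.2) (μ := P)
    (Y := outcome a) (measurable_outcome a).aemeasurable
  have hf' : Measurable fun p : (Fin 2 × Cov d) × ℝ => f p.2 p.1.1 p.1.2 :=
    hf.comp (f := fun p : (Fin 2 × Cov d) × ℝ => (p.2, p.1.1, p.1.2)) (by fun_prop)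
  have hm := (measurable_outcome (d := d) a)
  have h' : ∫⁻ z, f (outcome a z) z.2.2.1 z.2.2.2 ∂P =
      ∫⁻ p : (Fin 2 × Cov d) × ℝ, f p.2 p.1.1 p.1.2 ∂(P.map fun z => (z.2.2, outcome a z)) := by
    rw [lintegral_map hf' (by fun_prop)]
  rw [h', ← h, Measure.lintegral_compProd hf', ← Latent.snd_snd_eq_map, lintegral_eq_sum_propensity]
  exact hf'.lintegral_kernel_prod_right'

theorem measurable_latentPropensity (a : Fin 2) :
    Measurable fun p : ℝ × Cov d => latentPropensity P a p.1 p.2 :=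
  ((condDistrib (fun z : Latent d => z.2.2.1) (fun z : Latent d => (outcome a z, z.2.2.2))
    P).measurable_coe (measurableSet_singleton 1)).ennreal_toReal

theorem setLIntegral_latentPropensity (a : Fin 2) {S : Set (ℝ × Cov d)} (hS : MeasurableSet S) :
    ∫⁻ p in S, ENNReal.ofReal (latentPropensity P a p.1 p.2)
        ∂(P.map fun z => (outcome a z, z.2.2.2)) =
      P ((fun z => (outcome a z, z.2.2.2)) ⁻¹' S ∩ (fun z => z.2.2.1) ⁻¹' {1}) := by
  have hm := (measurable_outcome (d := d) a)
  rw [← setLIntegral_preimage_condDistrib (X := fun z : Latent d => (outcome a z, z.2.2.2))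
    (Y := fun z : Latent d => z.2.2.1) (by fun_prop) (by fun_prop) (measurableSet_singleton 1) hS,
    setLIntegral_map hS (measurable_latentPropensity P a).ennreal_ofReal (by fun_prop)]
  refine lintegral_congr fun z => ?_
  rw [latentPropensity, ofReal_measureReal]

/-- The conditional law of `Y_a` given `(X, W) = (x, w)`, weighted by `P(X = x | W = w)`. -/
noncomputable def weightedOutcome (a x : Fin 2) (w : Cov d) : Measure ℝ :=
  ENNReal.ofReal (propensity P.snd.snd x w) •
    condDistrib (outcome a) (fun z : Latent d => z.2.2) P (x, w)

theorem weightedOutcome_apply (a x : Fin 2) (w : Cov d) (A : Set ℝ) :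
    weightedOutcome P a x w A = ENNReal.ofReal (propensity P.snd.snd x w) *
      condDistrib (outcome a) (fun z : Latent d => z.2.2) P (x, w) A := rfl

theorem measurable_weightedOutcome (a x : Fin 2) {A : Set ℝ} (hA : MeasurableSet A) :
    Measurable fun w => weightedOutcome P a x w A :=
  (measurable_propensity _ x).ennreal_ofReal.mul
    (((condDistrib (outcome a) (fun z : Latent d => z.2.2) P).measurable_coe hA).comp
      measurable_prodMk_left)

theorem measure_treated_eq (a : Fin 2) {S : Set (ℝ × Cov d)} (hS : MeasurableSet S) :
    P ((fun z => (outcome a z, z.2.2.2)) ⁻¹' S ∩ (fun z => z.2.2.1) ⁻¹' {1}) =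
      ∫⁻ w, weightedOutcome P a 1 w ((fun y => (y, w)) ⁻¹' S) ∂P.snd.snd.snd := by
  have hm := (measurable_outcome (d := d) a)
  have hT : MeasurableSet {p : ℝ × Fin 2 × Cov d | (p.1, p.2.2) ∈ S ∧ p.2.1 = 1} :=
    (hS.preimage (f := fun p : ℝ × Fin 2 × Cov d => (p.1, p.2.2)) (by fun_prop)).inter
      ((measurableSet_singleton (1 : Fin 2)).preimage
        (f := fun p : ℝ × Fin 2 × Cov d => p.2.1) (by fun_prop))
  have h := lintegral_outcome_eq P a (f := fun y x w =>
    {p : ℝ × Fin 2 × Cov d | (p.1, p.2.2) ∈ S ∧ p.2.1 = 1}.indicator 1 (y, x, w))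
    (measurable_one.indicator hT)
  have hl : P ((fun z => (outcome a z, z.2.2.2)) ⁻¹' S ∩ (fun z => z.2.2.1) ⁻¹' {1}) =
      ∫⁻ z, {p : ℝ × Fin 2 × Cov d | (p.1, p.2.2) ∈ S ∧ p.2.1 = 1}.indicator 1
        (outcome a z, z.2.2.1, z.2.2.2) ∂P := by
    rw [← lintegral_indicator_one]
    · rfl
    · exact hT.preimage (f := fun z : Latent d => (outcome a z, z.2.2.1, z.2.2.2)) (by fun_prop)
  rw [hl, h]
  refine lintegral_congr fun w => ?_
  rw [Fin.sum_univ_two]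
  have h0 : ∀ y : ℝ, {p : ℝ × Fin 2 × Cov d | (p.1, p.2.2) ∈ S ∧ p.2.1 = 1}.indicator
      (1 : ℝ × Fin 2 × Cov d → ENNReal) (y, 0, w) = 0 := fun y => indicator_of_notMem (by simp) _
  have h1 : ∀ y : ℝ, {p : ℝ × Fin 2 × Cov d | (p.1, p.2.2) ∈ S ∧ p.2.1 = 1}.indicator
      (1 : ℝ × Fin 2 × Cov d → ENNReal) (y, 1, w) = ((fun y => (y, w)) ⁻¹' S).indicator 1 y := by
    intro y
    by_cases hy : (y, w) ∈ S
    · simp [indicator, hy]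
    · simp [indicator, hy]
  simp only [h0, h1, lintegral_zero, mul_zero, zero_add]
  rw [lintegral_indicator_one (hS.preimage (by fun_prop))]
  rfl

theorem setLIntegral_covariate_eq (a : Fin 2) {S : Set (ℝ × Cov d)} (hS : MeasurableSet S)
    {c : Cov d → ENNReal} (hc : Measurable c) :
    ∫⁻ p in S, c p.2 ∂(P.map fun z => (outcome a z, z.2.2.2)) =
      ∫⁻ w, c w * (weightedOutcome P a 0 w ((fun y => (y, w)) ⁻¹' S) +
        weightedOutcome P a 1 w ((fun y => (y, w)) ⁻¹' S)) ∂P.snd.snd.snd := by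
  have hm := (measurable_outcome (d := d) a)
  have hg : Measurable (S.indicator fun p => c p.2) := (hc.comp measurable_snd).indicator hS
  rw [← lintegral_indicator hS, lintegral_map hg (by fun_prop)]
  have h := lintegral_outcome_eq P a (f := fun y _ w => S.indicator (fun p => c p.2) (y, w))
    (hg.comp (f := fun p : ℝ × Fin 2 × Cov d => (p.1, p.2.2)) (by fun_prop))
  rw [h]
  refine lintegral_congr fun w => ?_
  have hind : ∀ y : ℝ, S.indicator (fun p => c p.2) (y, w) =
      ((fun y => (y, w)) ⁻¹' S).indicator (fun _ => c w) y := fun y => rfl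
  have hS' : MeasurableSet ((fun y => (y, w)) ⁻¹' S) := hS.preimage (by fun_prop)
  simp only [hind, lintegral_indicator_const hS', Fin.sum_univ_two]
  rw [weightedOutcome_apply, weightedOutcome_apply]
  ring

/-- The bounds are integrated over `A ×ˢ B` for every measurable `B`, which localizes them in `w`.
The exceptional null set depends on `A`; this is harmless because only a half-line and its
complement are tested later. -/
theorem ae_weightedOutcome_mem_of_latentPropensity_mem {cl cu : Cov d → ℝ} (hcl : Measurable cl)
    (hcu : Measurable cu) {a : Fin 2}
    (h : ∀ᵐ z ∂P, latentPropensity P a (outcome a z) z.2.2.2 ∈ Icc (cl z.2.2.2) (cu z.2.2.2))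
    {A : Set ℝ} (hA : MeasurableSet A) :
    ∀ᵐ w ∂P.snd.snd.snd,
      ENNReal.ofReal (cl w) * (weightedOutcome P a 0 w A + weightedOutcome P a 1 w A) ≤
        weightedOutcome P a 1 w A ∧
      weightedOutcome P a 1 w A ≤
        ENNReal.ofReal (cu w) * (weightedOutcome P a 0 w A + weightedOutcome P a 1 w A) := by
  have hm := (measurable_outcome (d := d) a)
  have hW : ∀ x, Measurable fun w => weightedOutcome P a x w A :=
    fun x => measurable_weightedOutcome P a x hA
  have hlp := measurable_latentPropensity P a
  have h' : ∀ᵐ p ∂(P.map fun z => (outcome a z, z.2.2.2)),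
      latentPropensity P a p.1 p.2 ∈ Icc (cl p.2) (cu p.2) := by
    rw [ae_map_iff (by fun_prop)]
    · exact h
    · exact (measurableSet_le (hcl.comp measurable_snd) hlp).inter
        (measurableSet_le hlp (hcu.comp measurable_snd))
  have hsec : ∀ (B : Set (Cov d)) (μ : Cov d → Measure ℝ) (w : Cov d),
      μ w ((fun y => (y, w)) ⁻¹' (A ×ˢ B)) = B.indicator (fun w => μ w A) w := by
    intro B μ w
    by_cases hw : w ∈ B
    · rw [mk_preimage_prod_left hw, indicator_of_mem hw]
    · rw [mk_preimage_prod_left_eq_empty hw, indicator_of_notMem hw, measure_empty]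
  have h1 : ∀ B, MeasurableSet B →
      ∫⁻ p in A ×ˢ B, ENNReal.ofReal (latentPropensity P a p.1 p.2)
        ∂(P.map fun z => (outcome a z, z.2.2.2)) =
      ∫⁻ w in B, weightedOutcome P a 1 w A ∂P.snd.snd.snd := by
    intro B hB
    rw [setLIntegral_latentPropensity P a (hA.prod hB), measure_treated_eq P a (hA.prod hB),
      ← lintegral_indicator hB]
    exact lintegral_congr (hsec B _)
  have h2 : ∀ B, MeasurableSet B → ∀ c : Cov d → ENNReal, Measurable c →
      ∫⁻ p in A ×ˢ B, c p.2 ∂(P.map fun z => (outcome a z, z.2.2.2)) =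
      ∫⁻ w in B, c w * (weightedOutcome P a 0 w A + weightedOutcome P a 1 w A)
        ∂P.snd.snd.snd := by
    intro B hB c hc
    rw [setLIntegral_covariate_eq P a (hA.prod hB) hc, ← lintegral_indicator hB]
    refine lintegral_congr fun w => ?_
    rw [hsec B, hsec B]
    by_cases hw : w ∈ B
    · simp only [indicator_of_mem hw]
    · simp only [indicator_of_notMem hw, add_zero, mul_zero]
  refine (ae_le_of_forall_setLIntegral_le_of_sigmaFinite
    (hcl.ennreal_ofReal.mul ((hW 0).add (hW 1))) fun B hB _ => ?_).and
    (ae_le_of_forall_setLIntegral_le_of_sigmaFinite (hW 1) fun B hB _ => ?_)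
  · refine ((h2 B hB _ hcl.ennreal_ofReal).symm.trans_le ?_).trans_eq (h1 B hB)
    refine lintegral_mono_ae (ae_restrict_of_ae ?_)
    filter_upwards [h'] with p hp using ENNReal.ofReal_le_ofReal hp.1
  · refine ((h1 B hB).symm.trans_le ?_).trans_eq (h2 B hB _ hcu.ennreal_ofReal)
    refine lintegral_mono_ae (ae_restrict_of_ae ?_)
    filter_upwards [h'] with p hp using ENNReal.ofReal_le_ofReal hp.2

/-- The sections of a set `S` in the `(y, w)` space vary with `w`, so the hypothesis is an
inequality of measures at almost every `w`; integrating it along the sections compares the integrals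
over every `S`. -/
theorem latentPropensity_mem_of_ae_weightedOutcome_mem {cl cu : Cov d → ℝ} (hcl : Measurable cl)
    (hcu : Measurable cu) (hpos : ∀ᵐ w ∂P.snd.snd.snd, 0 ≤ cu w) {a : Fin 2}
    (h : ∀ᵐ w ∂P.snd.snd.snd,
      ENNReal.ofReal (cl w) • (weightedOutcome P a 0 w + weightedOutcome P a 1 w) ≤
        weightedOutcome P a 1 w ∧
      weightedOutcome P a 1 w ≤
        ENNReal.ofReal (cu w) • (weightedOutcome P a 0 w + weightedOutcome P a 1 w)) :
    ∀ᵐ z ∂P, latentPropensity P a (outcome a z) z.2.2.2 ∈ Icc (cl z.2.2.2) (cu z.2.2.2) := by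
  have hm := (measurable_outcome (d := d) a)
  have hlp := measurable_latentPropensity P a
  have h1 : (fun p : ℝ × Cov d => ENNReal.ofReal (cl p.2))
      ≤ᵐ[P.map fun z => (outcome a z, z.2.2.2)]
      fun p => ENNReal.ofReal (latentPropensity P a p.1 p.2) := by
    have : IsProbabilityMeasure (P.map fun z => (outcome a z, z.2.2.2)) :=
      Measure.isProbabilityMeasure_map (by fun_prop)
    refine ae_le_of_forall_setLIntegral_le_of_sigmaFinite
      (hcl.comp measurable_snd).ennreal_ofReal fun S hS _ => ?_
    rw [setLIntegral_covariate_eq P a hS hcl.ennreal_ofReal, setLIntegral_latentPropensity P a hS,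
      measure_treated_eq P a hS]
    refine lintegral_mono_ae ?_
    filter_upwards [h] with w hw using hw.1 _
  have h2 : (fun p : ℝ × Cov d => ENNReal.ofReal (latentPropensity P a p.1 p.2))
      ≤ᵐ[P.map fun z => (outcome a z, z.2.2.2)] fun p => ENNReal.ofReal (cu p.2) := by
    have : IsProbabilityMeasure (P.map fun z => (outcome a z, z.2.2.2)) :=
      Measure.isProbabilityMeasure_map (by fun_prop)
    refine ae_le_of_forall_setLIntegral_le_of_sigmaFinite hlp.ennreal_ofReal fun S hS _ => ?_
    rw [setLIntegral_covariate_eq P a hS hcu.ennreal_ofReal, setLIntegral_latentPropensity P a hS,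
      measure_treated_eq P a hS]
    refine lintegral_mono_ae ?_
    filter_upwards [h] with w hw using hw.2 _
  have hpos' : ∀ᵐ z ∂P, 0 ≤ cu z.2.2.2 := by
    rw [Latent.snd_snd_eq_map, Measure.snd, Measure.map_map (by fun_prop) (by fun_prop)] at hpos
    exact ae_of_ae_map (f := fun z : Latent d => z.2.2.2) (by fun_prop) hpos
  filter_upwards [ae_of_ae_map (by fun_prop) h1, ae_of_ae_map (by fun_prop) h2, hpos']
    with z hz1 hz2 hz3
  exact ⟨(ENNReal.ofReal_le_ofReal_iff measureReal_nonneg).1 hz1,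
    (ENNReal.ofReal_le_ofReal_iff hz3).1 hz2⟩

end LatentPropensity

/-! ### Relative slopes -/

section Slopes

variable {d : ℕ} (ρ : Measure (Fin 2 × Cov d)) [IsProbabilityMeasure ρ] (cl cu : Cov d → ℝ)

/-- The bounds on the propensity score required by marginal `c`-dependence. -/
def PropensityBounds (w : Cov d) : Prop :=
  0 < cl w ∧ cl w ≤ propensity ρ 1 w ∧ propensity ρ 1 w ≤ cu w ∧ cu w < 1

/-- The smallest density of `Y_a` given `X ≠ a` relative to `Y_a` given `X = a`. -/
noncomputable def slopeLower (a : Fin 2) (w : Cov d) : ℝ :=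
  open scoped Classical in
  if PropensityBounds ρ cl cu w then
    if a = 1 then propensity ρ 1 w * (1 - cu w) / (propensity ρ 0 w * cu w)
    else propensity ρ 0 w * cl w / (propensity ρ 1 w * (1 - cl w))
  -- Slope 1 makes `distort` the identity on cdf values, so the interpolated cdfs are genuine cdfs
  -- at every `w`, as the identified set demands.
  else 1

/-- The largest density of `Y_a` given `X ≠ a` relative to `Y_a` given `X = a`. -/
noncomputable def slopeUpper (a : Fin 2) (w : Cov d) : ℝ :=
  open scoped Classical in
  if PropensityBounds ρ cl cu w then
    if a = 1 then propensity ρ 1 w * (1 - cl w) / (propensity ρ 0 w * cl w)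
    else propensity ρ 0 w * cu w / (propensity ρ 1 w * (1 - cu w))
  else 1

variable {ρ cl cu}

theorem PropensityBounds.pos {w : Cov d} (h : PropensityBounds ρ cl cu w) :
    0 < cl w ∧ 0 < 1 - cl w ∧ 0 < cu w ∧ 0 < 1 - cu w ∧ 0 < propensity ρ 0 w ∧
      0 < propensity ρ 1 w := by
  obtain ⟨h1, h2, h3, h4⟩ := h
  rw [propensity_zero]
  refine ⟨h1, ?_, ?_, ?_, ?_, ?_⟩ <;> linarith

theorem PropensityBounds.propensity_pos {w : Cov d} (h : PropensityBounds ρ cl cu w) (x : Fin 2) :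
    0 < propensity ρ x w := by
  obtain ⟨-, -, -, -, h0, h1⟩ := h.pos
  fin_cases x
  exacts [h0, h1]

/-- The left side is `cl ≤ p₁ f₁ / (p₀ f₀ + p₁ f₁) ≤ cu` with denominators cleared. Necessity uses
it with `f` the mass of an event in each arm, sufficiency with `f` an increment of the cdfs. -/
theorem PropensityBounds.slope_bounds_iff {w : Cov d} (h : PropensityBounds ρ cl cu w) (a : Fin 2)
    (f : Fin 2 → ℝ) :
    (cl w * propensity ρ 0 w * f 0 ≤ (1 - cl w) * propensity ρ 1 w * f 1 ∧
      (1 - cu w) * propensity ρ 1 w * f 1 ≤ cu w * propensity ρ 0 w * f 0) ↔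
    ∀ x, x ≠ a → f x ∈ Icc (slopeLower ρ cl cu a w * f a) (slopeUpper ρ cl cu a w * f a) := by
  obtain ⟨h1, h2, h3, h4, h5, h6⟩ := h.pos
  fin_cases a
  · simp only [slopeLower, slopeUpper, if_pos h, Fin.forall_fin_two, mem_Icc, Fin.zero_eta,
      zero_ne_one, if_false, ne_eq, not_true_eq_false, false_imp_iff, true_and, one_ne_zero,
      not_false_eq_true, true_imp_iff, div_mul_eq_mul_div]
    rw [div_le_iff₀ (by positivity), le_div_iff₀ (by positivity)]
    constructor <;> rintro ⟨ha, hb⟩ <;> constructor <;> linarith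
  · simp only [slopeLower, slopeUpper, if_pos h, Fin.forall_fin_two, mem_Icc, Fin.mk_one,
      zero_ne_one, if_true, ne_eq, not_true_eq_false, false_imp_iff, and_true,
      not_false_eq_true, true_imp_iff, div_mul_eq_mul_div]
    rw [div_le_iff₀ (by positivity), le_div_iff₀ (by positivity)]
    constructor <;> rintro ⟨ha, hb⟩ <;> constructor <;> linarith

variable (ρ cl cu)

theorem slopeLower_nonneg (a : Fin 2) (w : Cov d) : 0 ≤ slopeLower ρ cl cu a w := by
  unfold slopeLower
  split_ifs with h ha
  · obtain ⟨h1, h2, h3, h4, h5, h6⟩ := h.pos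
    positivity
  · obtain ⟨h1, h2, h3, h4, h5, h6⟩ := h.pos
    positivity
  · exact zero_le_one

/-- Clearing denominators leaves `p₁ ≤ cu` for `a = 1` and `cl ≤ p₁` for `a = 0`. -/
theorem slopeLower_le_one (a : Fin 2) (w : Cov d) : slopeLower ρ cl cu a w ≤ 1 := by
  unfold slopeLower
  split_ifs with h ha
  · obtain ⟨h1, h2, h3, h4, h5, h6⟩ := h.pos
    rw [div_le_one (by positivity), propensity_zero]
    linarith [h.2.2.1]
  · obtain ⟨h1, h2, h3, h4, h5, h6⟩ := h.pos
    rw [div_le_one (by positivity), propensity_zero]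
    linarith [h.2.1]
  · exact le_rfl

theorem one_le_slopeUpper (a : Fin 2) (w : Cov d) : 1 ≤ slopeUpper ρ cl cu a w := by
  unfold slopeUpper
  split_ifs with h ha
  · obtain ⟨h1, h2, h3, h4, h5, h6⟩ := h.pos
    rw [one_le_div (by positivity), propensity_zero]
    linarith [h.2.1]
  · obtain ⟨h1, h2, h3, h4, h5, h6⟩ := h.pos
    rw [one_le_div (by positivity), propensity_zero]
    linarith [h.2.2.1]
  · exact le_rfl

variable {cl cu}

theorem measurableSet_propensityBounds (hcl : Measurable cl) (hcu : Measurable cu) :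
    MeasurableSet {w | PropensityBounds ρ cl cu w} := by
  have hp := measurable_propensity ρ 1
  exact (measurableSet_lt measurable_const hcl).inter ((measurableSet_le hcl hp).inter
    ((measurableSet_le hp hcu).inter (measurableSet_lt hcu measurable_const)))

theorem measurable_slopeLower (hcl : Measurable cl) (hcu : Measurable cu) (a : Fin 2) :
    Measurable (slopeLower ρ cl cu a) := by
  have h0 := measurable_propensity ρ 0
  have h1 := measurable_propensity ρ 1
  refine Measurable.ite (measurableSet_propensityBounds ρ hcl hcu) ?_ measurable_const
  split_ifs <;> fun_prop

theorem measurable_slopeUpper (hcl : Measurable cl) (hcu : Measurable cu) (a : Fin 2) :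
    Measurable (slopeUpper ρ cl cu a) := by
  have h0 := measurable_propensity ρ 0
  have h1 := measurable_propensity ρ 1
  refine Measurable.ite (measurableSet_propensityBounds ρ hcl hcu) ?_ measurable_const
  split_ifs <;> fun_prop

end Slopes

/-! ### Necessity of the bounds -/

section Necessity

variable {d : ℕ} (P : Measure (Latent d)) [IsProbabilityMeasure P] {cl cu : Cov d → ℝ}

theorem weightedOutcome_eq_ofReal (a x : Fin 2) (w : Cov d) (A : Set ℝ) :
    weightedOutcome P a x w A = ENNReal.ofReal (propensity P.snd.snd x w *
      (condDistrib (outcome a) (fun z : Latent d => z.2.2) P (x, w)).real A) := by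
  rw [weightedOutcome_apply, ENNReal.ofReal_mul (propensity_nonneg _ _ _), ofReal_measureReal]

theorem MarginalCDependence.outcomeCDF_mem (h : MarginalCDependence P cl cu) (hcl : Measurable cl)
    (hcu : Measurable cu) (a : Fin 2) (y : ℝ) :
    ∀ᵐ w ∂P.snd.snd.snd, ∀ x, x ≠ a → outcomeCDF P a x w y ∈
      Icc (distort (slopeLower P.snd.snd cl cu a w) (slopeUpper P.snd.snd cl cu a w) 0
          (outcomeCDF P a a w y))
        (distort (slopeLower P.snd.snd cl cu a w) (slopeUpper P.snd.snd cl cu a w) 1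
          (outcomeCDF P a a w y)) := by
  have hreal : ∀ A : Set ℝ, MeasurableSet A → ∀ᵐ w ∂P.snd.snd.snd, ∀ x, x ≠ a →
      (condDistrib (outcome a) (fun z : Latent d => z.2.2) P (x, w)).real A ∈
        Icc (slopeLower P.snd.snd cl cu a w *
            (condDistrib (outcome a) (fun z : Latent d => z.2.2) P (a, w)).real A)
          (slopeUpper P.snd.snd cl cu a w *
            (condDistrib (outcome a) (fun z : Latent d => z.2.2) P (a, w)).real A) := by
    intro A hA
    filter_upwards [ae_weightedOutcome_mem_of_latentPropensity_mem P hcl hcu (h.latent a) hA,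
      h.bounds] with w hw hb
    have hb' : PropensityBounds P.snd.snd cl cu w := hb
    obtain ⟨h1, h2, h3, h4, h5, h6⟩ := hb'.pos
    refine (hb'.slope_bounds_iff a fun x =>
      (condDistrib (outcome a) (fun z : Latent d => z.2.2) P (x, w)).real A).1 ?_
    have hn : ∀ x, 0 ≤ propensity P.snd.snd x w *
        (condDistrib (outcome a) (fun z : Latent d => z.2.2) P (x, w)).real A :=
      fun x => mul_nonneg (propensity_nonneg _ _ _) measureReal_nonneg
    simp only [weightedOutcome_eq_ofReal] at hw
    rw [← ENNReal.ofReal_add (hn 0) (hn 1), ← ENNReal.ofReal_mul h1.le, ← ENNReal.ofReal_mul h3.le,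
      ENNReal.ofReal_le_ofReal_iff (hn 1),
      ENNReal.ofReal_le_ofReal_iff (mul_nonneg h3.le (add_nonneg (hn 0) (hn 1)))] at hw
    constructor <;> linarith [hw.1, hw.2]
  -- The half-line gives the two terms through the origin, its complement the two terms through `(1,
  -- 1)`.
  filter_upwards [hreal _ measurableSet_Iic, hreal _ measurableSet_Iic.compl] with w hw hw' x hx
  have e1 := hw x hx
  have e2 := hw' x hx
  rw [probReal_compl_eq_one_sub measurableSet_Iic, probReal_compl_eq_one_sub measurableSet_Iic]
    at e2
  unfold outcomeCDF distort
  rw [sub_zero, one_mul, zero_mul, add_zero, sub_self, zero_mul, zero_add, one_mul]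
  exact ⟨max_le e1.1 (by linarith [e2.2]), le_min e1.2 (by linarith [e2.1])⟩

end Necessity

/-! ### Sufficiency of the bounds -/

theorem le_of_monotone_weighted_sub {μ₀ μ₁ : Measure ℝ} [IsProbabilityMeasure μ₀]
    [IsProbabilityMeasure μ₁] {q₀ q₁ : ℝ} (hq₀ : 0 ≤ q₀) (hq₁ : 0 ≤ q₁)
    (h : Monotone fun y => q₁ * μ₁.real (Iic y) - q₀ * μ₀.real (Iic y)) :
    ENNReal.ofReal q₀ • μ₀ ≤ ENNReal.ofReal q₁ • μ₁ :=
  measure_le_smul_of_monotone_sub (c := q₁.toNNReal) (c' := q₀.toNNReal) (by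
    simpa only [Real.coe_toNNReal _ hq₀, Real.coe_toNNReal _ hq₁] using h)

theorem smul_add_le_of_monotone {μ₀ μ₁ : Measure ℝ} [IsProbabilityMeasure μ₀]
    [IsProbabilityMeasure μ₁] {p₀ p₁ c : ℝ} (hp₀ : 0 ≤ p₀) (hp₁ : 0 ≤ p₁) (hc : 0 ≤ c)
    (hc' : 0 ≤ 1 - c)
    (h : ∀ y y', y ≤ y' → c * p₀ * (μ₀.real (Iic y') - μ₀.real (Iic y)) ≤
      (1 - c) * p₁ * (μ₁.real (Iic y') - μ₁.real (Iic y))) :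
    ENNReal.ofReal c • (ENNReal.ofReal p₀ • μ₀ + ENNReal.ofReal p₁ • μ₁) ≤
      ENNReal.ofReal p₁ • μ₁ := by
  have hle := le_of_monotone_weighted_sub (mul_nonneg hc hp₀) (mul_nonneg hc' hp₁)
    (μ₀ := μ₀) (μ₁ := μ₁) fun y y' hy => by linarith [h y y' hy]
  -- Measures cannot be subtracted, so the common part `c p₁ μ₁` is added to both sides of `c p₀ μ₀
  -- ≤ (1 - c) p₁ μ₁`.
  have hsplit : ENNReal.ofReal p₁ = ENNReal.ofReal ((1 - c) * p₁) + ENNReal.ofReal (c * p₁) := by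
    rw [← ENNReal.ofReal_add (mul_nonneg hc' hp₁) (mul_nonneg hc hp₁)]
    congr 1; ring
  rw [smul_add, smul_smul, smul_smul, ← ENNReal.ofReal_mul hc, ← ENNReal.ofReal_mul hc]
  conv_rhs => rw [hsplit, add_smul]
  exact add_le_add_left hle _

theorem le_smul_add_of_monotone {μ₀ μ₁ : Measure ℝ} [IsProbabilityMeasure μ₀]
    [IsProbabilityMeasure μ₁] {p₀ p₁ c : ℝ} (hp₀ : 0 ≤ p₀) (hp₁ : 0 ≤ p₁) (hc : 0 ≤ c)
    (hc' : 0 ≤ 1 - c)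
    (h : ∀ y y', y ≤ y' → (1 - c) * p₁ * (μ₁.real (Iic y') - μ₁.real (Iic y)) ≤
      c * p₀ * (μ₀.real (Iic y') - μ₀.real (Iic y))) :
    ENNReal.ofReal p₁ • μ₁ ≤
      ENNReal.ofReal c • (ENNReal.ofReal p₀ • μ₀ + ENNReal.ofReal p₁ • μ₁) := by
  have hle := le_of_monotone_weighted_sub (mul_nonneg hc' hp₁) (mul_nonneg hc hp₀)
    (μ₀ := μ₁) (μ₁ := μ₀) fun y y' hy => by linarith [h y y' hy]
  have hsplit : ENNReal.ofReal p₁ = ENNReal.ofReal ((1 - c) * p₁) + ENNReal.ofReal (c * p₁) := by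
    rw [← ENNReal.ofReal_add (mul_nonneg hc' hp₁) (mul_nonneg hc hp₁)]
    congr 1; ring
  rw [smul_add, smul_smul, smul_smul, ← ENNReal.ofReal_mul hc, ← ENNReal.ofReal_mul hc]
  conv_lhs => rw [hsplit, add_smul]
  exact add_le_add_left hle _

theorem propensity_congr {d : ℕ} {ρ ρ' : Measure (Fin 2 × Cov d)} [IsProbabilityMeasure ρ]
    [IsProbabilityMeasure ρ'] (h : ρ = ρ') : propensity ρ = propensity ρ' := by
  subst h; rfl

section Sufficiency

variable {d : ℕ} (Q : Measure (Observed d)) [IsProbabilityMeasure Q] (cl cu : Cov d → ℝ)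

/-- The conditional cdf of `Y_a` given `(X, W)` which agrees with the data for `X = a` and
interpolates between the extreme cdfs with weight `t` on the upper one for `X ≠ a`. -/
noncomputable def interpolatedCDF (t : ℝ) (a : Fin 2) : CDFFamily d := fun x w y =>
  if x = a then observedCDF Q a w y
  else distort (slopeLower Q.snd cl cu a w) (slopeUpper Q.snd cl cu a w) t (observedCDF Q a w y)

theorem isCDF_interpolatedCDF {t : ℝ} (ht : t ∈ Icc (0 : ℝ) 1) (a x : Fin 2) (w : Cov d) :
    IsCDF (interpolatedCDF Q cl cu t a x w) := by
  have hG : IsCDF (observedCDF Q a w) := isCDF_measureReal_Iic _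
  unfold interpolatedCDF
  split_ifs with h
  · exact hG
  · exact hG.distort_comp (slopeLower_nonneg _ _ _ _ _) (slopeLower_le_one _ _ _ _ _)
      (one_le_slopeUpper _ _ _ _ _) ht

theorem continuous_interpolatedCDF (a x : Fin 2) (w : Cov d) (y : ℝ) :
    Continuous fun t => interpolatedCDF Q cl cu t a x w y := by
  unfold interpolatedCDF distort
  split_ifs <;> fun_prop

variable {cl cu}

theorem measurable_interpolatedCDF (hcl : Measurable cl) (hcu : Measurable cu) (t : ℝ) (a : Fin 2)
    (y : ℝ) : Measurable fun v : Fin 2 × Cov d => interpolatedCDF Q cl cu t a v.1 v.2 y := by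
  have hG : Measurable fun w => observedCDF Q a w y :=
    (((condDistrib Prod.fst Prod.snd Q).measurable_coe measurableSet_Iic).comp
      measurable_prodMk_left).ennreal_toReal
  have hL := measurable_slopeLower Q.snd hcl hcu a
  have hU := measurable_slopeUpper Q.snd hcl hcu a
  refine Measurable.ite (measurable_fst (measurableSet_singleton a)) (hG.comp measurable_snd) ?_
  unfold distort
  fun_prop

theorem interpolatedCDF_sub {t : ℝ} (ht : t ∈ Icc (0 : ℝ) 1) (a : Fin 2) {w : Cov d} {y y' : ℝ}
    (hy : y ≤ y') (x : Fin 2) (hx : x ≠ a) :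
    interpolatedCDF Q cl cu t a x w y' - interpolatedCDF Q cl cu t a x w y ∈
      Icc (slopeLower Q.snd cl cu a w *
          (interpolatedCDF Q cl cu t a a w y' - interpolatedCDF Q cl cu t a a w y))
        (slopeUpper Q.snd cl cu a w *
          (interpolatedCDF Q cl cu t a a w y' - interpolatedCDF Q cl cu t a a w y)) := by
  have hG : IsCDF (observedCDF Q a w) := isCDF_measureReal_Iic _
  simp only [interpolatedCDF, if_neg hx, if_true]
  exact distort_sub_mem ((slopeLower_le_one _ _ _ _ _).trans (one_le_slopeUpper _ _ _ _ _)) ht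
    (hG.mono hy)

theorem interpolated_mem_identifiedSetMarg (hcl : Measurable cl) (hcu : Measurable cu)
    (hb : ∀ᵐ w ∂Q.snd.snd, PropensityBounds Q.snd cl cu w) {t : ℝ} (ht : t ∈ Icc (0 : ℝ) 1) :
    (interpolatedCDF Q cl cu t 1, interpolatedCDF Q cl cu t 0, fun _ _ => frechetCopula t) ∈
      identifiedSetMarg Q cl cu := by
  have hcdf := isCDF_interpolatedCDF Q cl cu ht
  obtain ⟨κ, hκ, hjoint, h₁, h₀⟩ := exists_coupling_frechetCopula
    (fun v : Fin 2 × Cov d => hcdf 1 v.1 v.2) (fun v => hcdf 0 v.1 v.2)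
    (measurable_interpolatedCDF Q hcl hcu t 1) (measurable_interpolatedCDF Q hcl hcu t 0) ht
  have hsnd : (latentLaw Q.snd κ).snd.snd = Q.snd := latentLaw_snd_snd
  have hmarg : ∀ a, ∀ᵐ v ∂Q.snd, ∀ y,
      (condDistrib (outcome a) (fun z : Latent d => z.2.2) (latentLaw Q.snd κ) v).real (Iic y) =
        interpolatedCDF Q cl cu t a v.1 v.2 y := by
    intro a
    filter_upwards [condDistrib_outcome_latentLaw (ρ := Q.snd) (κ := κ) a] with v hv y
    rw [hv]
    obtain rfl | rfl : a = 0 ∨ a = 1 := by fin_cases a <;> simp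
    · rw [← h₀ v y]
      simp only [zero_ne_one, if_false]
      rw [Kernel.map_apply _ measurable_snd, measureReal_def,
        Measure.map_apply measurable_snd measurableSet_Iic, measureReal_def]
    · rw [← h₁ v y]
      simp only [if_true]
      rw [Kernel.map_apply _ measurable_fst, measureReal_def,
        Measure.map_apply measurable_fst measurableSet_Iic, measureReal_def]
  let P' : ProbabilityMeasure (Latent d) := ⟨latentLaw Q.snd κ, inferInstance⟩
  refine ⟨hcdf 1, hcdf 0, fun _ _ => isCopula_frechetCopula ht, P', hsnd, hmarg 1, hmarg 0, ?_, ?_, ?_, ⟨?_, ?_⟩⟩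
  · filter_upwards [condDistrib_latentLaw (ρ := Q.snd) (κ := κ)] with v hv y₁ y₀
    show (condDistrib _ _ (latentLaw Q.snd κ) v).real _ = _
    rw [hv, hjoint]
  · exact ae_of_all _ fun w y => by simp [interpolatedCDF]
  · exact ae_of_all _ fun w y => by simp [interpolatedCDF]
  · show ∀ᵐ w ∂(latentLaw Q.snd κ).snd.snd.snd, PropensityBounds (latentLaw Q.snd κ).snd.snd cl cu w
    unfold PropensityBounds
    rw [propensity_congr hsnd, hsnd]
    exact hb
  · intro a
    refine latentPropensity_mem_of_ae_weightedOutcome_mem (latentLaw Q.snd κ) hcl hcu ?_ ?_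
    · rw [hsnd]
      filter_upwards [hb] with w hw using hw.pos.2.2.1.le
    · have hmarg' := (ae_iff_forall_ae_of_propensity_pos Q.snd
        (hb.mono fun w hw => hw.propensity_pos)).1 (hmarg a)
      unfold weightedOutcome
      rw [propensity_congr hsnd, hsnd]
      filter_upwards [hb, hmarg' 0, hmarg' 1] with w hw hw₀ hw₁
      obtain ⟨h1, h2, h3, h4, h5, h6⟩ := hw.pos
      -- The slope bounds on cdf increments are exactly the monotonicity needed for domination of
      -- the weighted laws.
      have hinc : ∀ y y', y ≤ y' → _ := fun y y' (hy : y ≤ y') =>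
        (hw.slope_bounds_iff a fun x =>
          interpolatedCDF Q cl cu t a x w y' - interpolatedCDF Q cl cu t a x w y).2
          (interpolatedCDF_sub Q ht a hy)
      refine ⟨smul_add_le_of_monotone h5.le h6.le h1.le h2.le fun y y' hy => ?_,
        le_smul_add_of_monotone h5.le h6.le h3.le h4.le fun y y' hy => ?_⟩
      · rw [hw₀, hw₀, hw₁, hw₁]
        exact (hinc y y' hy).1
      · rw [hw₀, hw₀, hw₁, hw₁]
        exact (hinc y y' hy).2

end Sufficiency

/-! ### The identified set of the joint cdf -/

section JointCDF

variable {d : ℕ} (Q : Measure (Observed d)) [IsProbabilityMeasure Q] {cl cu : Cov d → ℝ}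

theorem slopeLower_congr {ρ ρ' : Measure (Fin 2 × Cov d)} [IsProbabilityMeasure ρ]
    [IsProbabilityMeasure ρ'] (h : ρ = ρ') (cl cu : Cov d → ℝ) :
    slopeLower ρ cl cu = slopeLower ρ' cl cu := by
  subst h; rfl

theorem slopeUpper_congr {ρ ρ' : Measure (Fin 2 × Cov d)} [IsProbabilityMeasure ρ]
    [IsProbabilityMeasure ρ'] (h : ρ = ρ') (cl cu : Cov d → ℝ) :
    slopeUpper ρ cl cu = slopeUpper ρ' cl cu := by
  subst h; rfl

/-- With `β` the upper slope, `p₀ = 1 - p₁` gives `1 - β = (cl - p₁) / (cl p₀)`, which matches the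
constant term of the stated bound. -/
theorem lowerF₁_eq {w : Cov d} (h : PropensityBounds Q.snd cl cu w) (x : Fin 2) (y : ℝ) :
    lowerF₁ Q cl cu x w y = interpolatedCDF Q cl cu 0 1 x w y := by
  obtain ⟨h1, h2, h3, h4, h5, h6⟩ := h.pos
  have h0 := propensity_zero Q.snd w
  simp only [lowerF₁, interpolatedCDF, distort, slopeLower, slopeUpper, if_pos h, if_true]
  split_ifs
  · rfl
  · rw [sub_zero, one_mul, zero_mul, add_zero]
    congr 1
    · ring
    · field_simp
      rw [h0]; ring

theorem upperF₁_eq {w : Cov d} (h : PropensityBounds Q.snd cl cu w) (x : Fin 2) (y : ℝ) :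
    upperF₁ Q cl cu x w y = interpolatedCDF Q cl cu 1 1 x w y := by
  obtain ⟨h1, h2, h3, h4, h5, h6⟩ := h.pos
  have h0 := propensity_zero Q.snd w
  simp only [upperF₁, interpolatedCDF, distort, slopeLower, slopeUpper, if_pos h, if_true]
  split_ifs
  · rfl
  · rw [sub_self, zero_mul, one_mul, zero_add]
    congr 1
    · ring
    · field_simp
      rw [h0]; ring

theorem lowerF₀_eq {w : Cov d} (h : PropensityBounds Q.snd cl cu w) (x : Fin 2) (y : ℝ) :
    lowerF₀ Q cl cu x w y = interpolatedCDF Q cl cu 0 0 x w y := by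
  obtain ⟨h1, h2, h3, h4, h5, h6⟩ := h.pos
  have h0 := propensity_zero Q.snd w
  simp only [lowerF₀, interpolatedCDF, distort, slopeLower, slopeUpper, if_pos h, zero_ne_one,
    if_false]
  split_ifs
  · rfl
  · rw [sub_zero, one_mul, zero_mul, add_zero]
    congr 1
    · ring
    · field_simp
      rw [h0]; ring

theorem upperF₀_eq {w : Cov d} (h : PropensityBounds Q.snd cl cu w) (x : Fin 2) (y : ℝ) :
    upperF₀ Q cl cu x w y = interpolatedCDF Q cl cu 1 0 x w y := by
  obtain ⟨h1, h2, h3, h4, h5, h6⟩ := h.pos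
  have h0 := propensity_zero Q.snd w
  simp only [upperF₀, interpolatedCDF, distort, slopeLower, slopeUpper, if_pos h, zero_ne_one,
    if_false]
  split_ifs
  · rfl
  · rw [sub_self, zero_mul, one_mul, zero_add]
    congr 1
    · ring
    · field_simp
      rw [h0]; ring

variable (cl cu) in
/-- The joint conditional cdf at `(y₁, y₀)` given `(X, W) = v` which interpolates between the
extreme ones with weight `t` on the upper one. -/
noncomputable def interpolatedJointCDF (y₁ y₀ t : ℝ) (v : Fin 2 × Cov d) : ℝ :=
  frechetCopula t (interpolatedCDF Q cl cu t 1 v.1 v.2 y₁) (interpolatedCDF Q cl cu t 0 v.1 v.2 y₀)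

theorem measurable_interpolatedJointCDF (hcl : Measurable cl) (hcu : Measurable cu)
    (y₁ y₀ t : ℝ) : Measurable (interpolatedJointCDF Q cl cu y₁ y₀ t) := by
  have h1 := measurable_interpolatedCDF Q hcl hcu t 1 y₁
  have h0 := measurable_interpolatedCDF Q hcl hcu t 0 y₀
  unfold interpolatedJointCDF frechetCopula
  fun_prop

theorem norm_interpolatedJointCDF_le (y₁ y₀ : ℝ) {t : ℝ} (ht : t ∈ Icc (0 : ℝ) 1)
    (v : Fin 2 × Cov d) : ‖interpolatedJointCDF Q cl cu y₁ y₀ t v‖ ≤ 1 := by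
  have hC := isCopula_frechetCopula ht
  have h1 := (isCDF_interpolatedCDF Q cl cu ht 1 v.1 v.2).mem_Icc y₁
  have h0 := (isCDF_interpolatedCDF Q cl cu ht 0 v.1 v.2).mem_Icc y₀
  rw [Real.norm_eq_abs, abs_le]
  have hl := (le_max_right _ _).trans (hC.max_le h1 h0)
  have hu := (hC.le_min h1 h0).trans ((min_le_left _ _).trans h1.2)
  exact ⟨by unfold interpolatedJointCDF; linarith, hu⟩

theorem integrable_interpolatedJointCDF (hcl : Measurable cl) (hcu : Measurable cu) (y₁ y₀ : ℝ)
    {t : ℝ} (ht : t ∈ Icc (0 : ℝ) 1) : Integrable (interpolatedJointCDF Q cl cu y₁ y₀ t) Q.snd :=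
  .of_bound (measurable_interpolatedJointCDF Q hcl hcu y₁ y₀ t).aestronglyMeasurable 1
    (ae_of_all _ fun v => norm_interpolatedJointCDF_le Q y₁ y₀ ht v)

theorem continuousOn_integral_interpolatedJointCDF (hcl : Measurable cl) (hcu : Measurable cu)
    (y₁ y₀ : ℝ) :
    ContinuousOn (fun t => ∫ v, interpolatedJointCDF Q cl cu y₁ y₀ t v ∂Q.snd) (Icc 0 1) := by
  refine continuousOn_of_dominated (bound := fun _ => 1)
    (fun t _ => (measurable_interpolatedJointCDF Q hcl hcu y₁ y₀ t).aestronglyMeasurable)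
    (fun t ht => ae_of_all _ fun v => norm_interpolatedJointCDF_le Q y₁ y₀ ht v)
    (integrable_const _) (ae_of_all _ fun v => Continuous.continuousOn ?_)
  have h1 := continuous_interpolatedCDF Q cl cu 1 v.1 v.2 y₁
  have h0 := continuous_interpolatedCDF Q cl cu 0 v.1 v.2 y₀
  unfold interpolatedJointCDF frechetCopula
  fun_prop

/-- The families in `T` carry no measurability in `(x, w)`; it is inherited from the conditional
joint cdf of the witnessing law, which agrees almost everywhere. -/
theorem integrable_copula_of_mem {T : CDFFamily d × CDFFamily d × CopulaFamily d}
    (hT : T ∈ identifiedSetMarg Q cl cu) (y₁ y₀ : ℝ) :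
    Integrable (fun v => T.2.2 v.1 v.2 (T.1 v.1 v.2 y₁) (T.2.1 v.1 v.2 y₀)) Q.snd := by
  obtain ⟨-, -, -, P, -, -, -, hjoint, -⟩ := hT
  have hm : Measurable fun v : Fin 2 × Cov d =>
      jointOutcomeCDF (P : Measure (Latent d)) v.1 v.2 y₁ y₀ :=
    ((condDistrib (fun z : Latent d => (z.1, z.2.1)) (fun z : Latent d => z.2.2)
      (P : Measure (Latent d))).measurable_coe
      (measurableSet_Iic.prod measurableSet_Iic)).ennreal_toReal
  refine (Integrable.of_bound (μ := Q.snd) hm.aestronglyMeasurable 1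
    (ae_of_all _ fun v => ?_)).congr (hjoint.mono fun v hv => hv y₁ y₀)
  rw [Real.norm_eq_abs, jointOutcomeCDF, abs_of_nonneg measureReal_nonneg]
  exact measureReal_le_one

theorem thetaCDF_eq_integral {T : CDFFamily d × CDFFamily d × CopulaFamily d}
    (hT : T ∈ identifiedSetMarg Q cl cu) (y₁ y₀ : ℝ) :
    thetaCDF T.1 T.2.1 T.2.2 Q y₁ y₀ =
      ∫ v, T.2.2 v.1 v.2 (T.1 v.1 v.2 y₁) (T.2.1 v.1 v.2 y₀) ∂Q.snd :=
  (integral_eq_sum_propensity Q.snd (integrable_copula_of_mem Q hT y₁ y₀)).symm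

theorem interpolatedCDF_le_of_marginalCDependence (hcl : Measurable cl) (hcu : Measurable cu)
    (hb : ∀ᵐ w ∂Q.snd.snd, PropensityBounds Q.snd cl cu w) {P : Measure (Latent d)}
    [IsProbabilityMeasure P] (hP : P.snd.snd = Q.snd) (hdep : MarginalCDependence P cl cu)
    (a : Fin 2) {F : CDFFamily d} (hF : ∀ᵐ v ∂Q.snd, ∀ y, outcomeCDF P a v.1 v.2 y = F v.1 v.2 y)
    (hobs : ∀ᵐ w ∂Q.snd.snd, ∀ y, F a w y = observedCDF Q a w y) (y : ℝ) :
    ∀ᵐ v ∂Q.snd, F v.1 v.2 y ∈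
      Icc (interpolatedCDF Q cl cu 0 a v.1 v.2 y) (interpolatedCDF Q cl cu 1 a v.1 v.2 y) := by
  have hpos := hb.mono fun w hw => hw.propensity_pos
  have hmem := MarginalCDependence.outcomeCDF_mem P hdep hcl hcu a y
  rw [slopeLower_congr hP, slopeUpper_congr hP, hP] at hmem
  have hF' := ae_all_iff.2 ((ae_iff_forall_ae_of_propensity_pos Q.snd hpos).1 hF)
  refine (ae_iff_forall_ae_of_propensity_pos Q.snd hpos).2 fun x => ?_
  filter_upwards [hmem, hF', hobs] with w h1 h2 h3
  unfold interpolatedCDF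
  by_cases hx : x = a
  · subst hx
    rw [if_pos rfl, if_pos rfl, h3]
    exact ⟨le_rfl, le_rfl⟩
  · rw [if_neg hx, if_neg hx, ← h2 x y, ← h3, ← h2 a y]
    exact h1 x hx

theorem jointCDFIdentifiedSet_eq_Icc (hcl : Measurable cl) (hcu : Measurable cu)
    (hb : ∀ᵐ w ∂Q.snd.snd, PropensityBounds Q.snd cl cu w) (y₁ y₀ : ℝ) :
    jointCDFIdentifiedSet Q cl cu y₁ y₀ =
      Icc (∫ v, interpolatedJointCDF Q cl cu y₁ y₀ 0 v ∂Q.snd)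
        (∫ v, interpolatedJointCDF Q cl cu y₁ y₀ 1 v ∂Q.snd) := by
  apply Subset.antisymm
  · rintro _ ⟨T, hT, rfl⟩
    have hint := integrable_copula_of_mem Q hT y₁ y₀
    beta_reduce
    rw [thetaCDF_eq_integral Q hT]
    obtain ⟨hc₁, hc₀, hC, P, hP, hF₁, hF₀, -, ho₁, ho₀, hdep⟩ := hT
    have hm₁ := interpolatedCDF_le_of_marginalCDependence Q hcl hcu hb hP hdep 1 hF₁ ho₁ y₁
    have hm₀ := interpolatedCDF_le_of_marginalCDependence Q hcl hcu hb hP hdep 0 hF₀ ho₀ y₀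
    constructor
    · refine integral_mono_ae (integrable_interpolatedJointCDF Q hcl hcu y₁ y₀ (by simp)) hint ?_
      filter_upwards [hm₁, hm₀] with v h₁ h₀
      refine le_trans ?_ ((hC v.1 v.2).max_le ((hc₁ _ _).mem_Icc _) ((hc₀ _ _).mem_Icc _))
      rw [interpolatedJointCDF, frechetCopula, sub_zero, one_mul, zero_mul, add_zero]
      exact max_le_max (by linarith [h₁.1, h₀.1]) le_rfl
    · refine integral_mono_ae hint (integrable_interpolatedJointCDF Q hcl hcu y₁ y₀ (by simp)) ?_
      filter_upwards [hm₁, hm₀] with v h₁ h₀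
      refine ((hC v.1 v.2).le_min ((hc₁ _ _).mem_Icc _) ((hc₀ _ _).mem_Icc _)).trans ?_
      rw [interpolatedJointCDF, frechetCopula, sub_self, zero_mul, one_mul, zero_add]
      exact min_le_min h₁.2 h₀.2
  · intro θ hθ
    -- The same `t` drives both cdfs and the copula, so one real parameter reaches every value.
    obtain ⟨t, ht, rfl⟩ := intermediate_value_Icc zero_le_one
      (continuousOn_integral_interpolatedJointCDF Q hcl hcu y₁ y₀) hθ
    have hT := interpolated_mem_identifiedSetMarg Q hcl hcu hb ht
    exact ⟨_, hT, thetaCDF_eq_integral Q hT y₁ y₀⟩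

end JointCDF

theorem observedLaw_snd {d : ℕ} (P : Measure (Latent d)) : (observedLaw P).snd = P.snd.snd := by
  rw [observedLaw, Measure.snd, Measure.map_map measurable_snd measurable_observe,
    Latent.snd_snd_eq_map]
  rfl

theorem mainTheorem5 {d : ℕ} (P : Measure (Latent d)) [IsProbabilityMeasure P]
    (cl cu : Cov d → ℝ) (hcl : Measurable cl) (hcu : Measurable cu)
    (hoverlap : Overlap (observedLaw P).snd) (hdep : MarginalCDependence P cl cu) (y₁ y₀ : ℝ) :
    jointCDFIdentifiedSet (observedLaw P) cl cu y₁ y₀ =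
      Icc
        (∫ v, max (lowerF₁ (observedLaw P) cl cu v.1 v.2 y₁ +
          lowerF₀ (observedLaw P) cl cu v.1 v.2 y₀ - 1) 0 ∂(observedLaw P).snd)
        (∫ v, min (upperF₁ (observedLaw P) cl cu v.1 v.2 y₁)
          (upperF₀ (observedLaw P) cl cu v.1 v.2 y₀) ∂(observedLaw P).snd) := by
  have hb : ∀ᵐ w ∂(observedLaw P).snd.snd, PropensityBounds (observedLaw P).snd cl cu w := by
    unfold PropensityBounds
    rw [propensity_congr (observedLaw_snd P), observedLaw_snd P]
    exact hdep.bounds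
  have hb' : ∀ᵐ v ∂(observedLaw P).snd, PropensityBounds (observedLaw P).snd cl cu v.2 :=
    ae_of_ae_map (f := Prod.snd) measurable_snd.aemeasurable hb
  rw [jointCDFIdentifiedSet_eq_Icc (observedLaw P) hcl hcu hb]
  congr 1
  · refine integral_congr_ae (hb'.mono fun v hv => ?_)
    simp only [lowerF₁_eq _ hv, lowerF₀_eq _ hv, interpolatedJointCDF, frechetCopula, sub_zero,
      one_mul, zero_mul, add_zero]
  · refine integral_congr_ae (hb'.mono fun v hv => ?_)
    simp only [upperF₁_eq _ hv, upperF₀_eq _ hv, interpolatedJointCDF, frechetCopula, sub_self,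
      one_mul, zero_mul, zero_add]
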